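/- Let $f(x,y)$ be a real polynomial of degree $d$ all of whose real critical points are isolated (there may be none), let $f_d$ be its homogeneous term of degree $d$, and let $p=[a,b,0]$, with $(a,b)\in\mathbf R^2\setminus\{0\}$, be a point of the line at infinity $\mathbf L=\{z=0\}$ of the real projective plane $\mathbf P^2$. Let $d_p$ be the multiplicity of the factor $bx-ay$ in $f_d$. Definitions. The curve of tangencies of $f$ is $x f_y-y f_x=0$; it is the set of points where the level sets of $f$ are tangent to circles centred at the origin. Let $\Gamma_{\mathbf C}$ be the complexification of its projective completion, let $\mathbf L_{\mathbf C}$ be the complex line at infinity, and let $(\Gamma_{\mathbf C}\cdot\mathbf L_{\mathbf C})_p$ be their intersection number at $p$. Let $C$ be a circle of radius $R$ centred at the origin. The ends $\gamma$ are the connected components, going to infinity, of the part of the real curve of tangencies exterior to $C$. For $R$ large, each end $\gamma$ has an endpoint $p(\gamma)\in\mathbf L$ (its limit in $\mathbf P^2$) and a limiting value $c(\gamma)\in\mathbf R\cup\{\infty\}$ of $f$. To a point $q\ne0$ of the curve of tangencies one assigns $-1/2$ if, near $q$ and apart from $q$, the level curve of $f$ through $q$ lies outside the circle through $q$ centred at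 the origin, $+1/2$ if it lies inside that circle, and $0$ otherwise; $i(\gamma)$ is the value of this number at all points of $\gamma$ sufficiently far from the origin. For $c\in\mathbf R\cup\{\infty\}$ put $$i^{abs}_{p,c}=\sum_{p(\gamma)=p,\ c(\gamma)=c}|i(\gamma)|,\qquad i^{abs}_p=\sum_{c\in\mathbf R\cup\{\infty\}}i^{abs}_{p,c},$$ and let $i^{T,abs}_p$ and $i^{N,abs}_p$ be the same sums restricted, respectively, to the ends that are tangent to $\mathbf L$ at $p$ and to those that are not. Statement. For every $p\in\mathbf L$ with $d_p>0$ (that is, for every real zero $p$ of $f_d$), $$(\Gamma_{\mathbf C}\cdot\mathbf L_{\mathbf C})_p=d_p-1 .$$ Moreover there is an $R_0$, depending only on $f$, such that for every $R\ge R_0$ and every $p\in\mathbf L$ with $d_p>0$, $$i^{abs}_p\le d_p-1\qquad\text{and}\qquad i^{N,abs}_p+2\,i^{T,abs}_p\le d_p-1 .$$ -/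

import Mathlib

open Filter Topology
open scoped ENNReal

/-! ### The curve of tangencies and its ends -/

/-- The Euclidean plane, with the Euclidean norm. -/
abbrev Plane : Type := EuclideanSpace ℝ (Fin 2)

/-- The value of the real polynomial `f(x, y)` at a point of the plane. -/
noncomputable def polyVal (f : MvPolynomial (Fin 2) ℝ) (q : Plane) : ℝ :=
  MvPolynomial.eval (fun i => q i) f

/-- `q` is a (real) critical point of `f`. -/
def IsCriticalPt (f : MvPolynomial (Fin 2) ℝ) (q : Plane) : Prop :=
  ∀ i : Fin 2, polyVal (MvPolynomial.pderiv i f) q = 0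

/-- Every real critical point of `f` is isolated in the set of real critical points
(there may be none). -/
def HasIsolatedCriticalPts (f : MvPolynomial (Fin 2) ℝ) : Prop :=
  ∀ q : Plane, IsCriticalPt f q → ∀ᶠ x in 𝓝[≠] q, ¬ IsCriticalPt f x

/-- The polynomial `x f_y - y f_x`, the equation of the curve of tangencies: the points where
the level sets of `f` are tangent to circles centred at the origin. -/
noncomputable def tangencyPoly (f : MvPolynomial (Fin 2) ℝ) : MvPolynomial (Fin 2) ℝ :=
  MvPolynomial.X 0 * MvPolynomial.pderiv 1 f - MvPolynomial.X 1 * MvPolynomial.pderiv 0 f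

/-- The part of the real curve of tangencies outside the circle of radius `R` about the origin. -/
def exteriorTangencyCurve (f : MvPolynomial (Fin 2) ℝ) (R : ℝ) : Set Plane :=
  {q | polyVal (tangencyPoly f) q = 0 ∧ R < ‖q‖}

/-- The ends of the curve of tangencies outside the circle of radius `R`: the connected components
of the exterior part that go to infinity. (For large `R` every component does.) -/
def tangencyEnds (f : MvPolynomial (Fin 2) ℝ) (R : ℝ) : Set (Set Plane) :=
  {γ | (∃ q ∈ exteriorTangencyCurve f R, γ = connectedComponentIn (exteriorTangencyCurve f R) q) ∧
    ¬ Bornology.IsBounded γ}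

/-- The filter "`q` goes to infinity along `γ`". -/
def alongEnd (γ : Set Plane) : Filter Plane :=
  Bornology.cobounded Plane ⊓ 𝓟 γ

/-! ### The numbers `i(γ)` -/

/-- Near `q`, the level set of `f` through `q` lies outside the circle about the origin
through `q` (touching it only at `q`). -/
def LevelOutside (f : MvPolynomial (Fin 2) ℝ) (q : Plane) : Prop :=
  ∀ᶠ x in 𝓝[≠] q, polyVal f x = polyVal f q → ‖q‖ < ‖x‖

/-- Near `q`, the level set of `f` through `q` lies inside the circle about the origin
through `q` (touching it only at `q`). -/
def LevelInside (f : MvPolynomial (Fin 2) ℝ) (q : Plane) : Prop :=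
  ∀ᶠ x in 𝓝[≠] q, polyVal f x = polyVal f q → ‖x‖ < ‖q‖

open Classical in
/-- The number `-1/2`, `+1/2` or `0` attached to a point `q` where a smooth level curve of `f` is
tangent to a circle about the origin: `-1/2` if the level curve is locally outside, `+1/2` if it
is locally inside, and `0` otherwise. -/
noncomputable def tangencyIndex (f : MvPolynomial (Fin 2) ℝ) (q : Plane) : ℝ :=
  if LevelOutside f q then -1 / 2 else if LevelInside f q then 1 / 2 else 0

open Classical in
/-- `i(γ)`: the number among `-1/2`, `+1/2`, `0` that is attached to all points of `γ`
sufficiently far out. -/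
noncomputable def endIndex (f : MvPolynomial (Fin 2) ℝ) (γ : Set Plane) : ℝ :=
  if ∀ᶠ q in alongEnd γ, tangencyIndex f q = -1 / 2 then -1 / 2
  else if ∀ᶠ q in alongEnd γ, tangencyIndex f q = 1 / 2 then 1 / 2
  else 0

/-! ### Behaviour at the point `p = [a, b, 0]` of the line at infinity

For real `(a, b) ≠ (0, 0)`, the map `(u, v) ↦ [a - b u, b + a u, v]` is an affine chart of the
projective plane, in which `p` is the origin and the line at infinity is `v = 0`. The affine point
`(x, y) = [x, y, 1]` lies in the chart when `a x + b y ≠ 0`, and then it has the coordinates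
`u = (a y - b x) / (a x + b y)` and `v = (a² + b²) / (a x + b y)`. -/

/-- The coordinate `u` in the chart at `[a, b, 0]`. -/
noncomputable def chartU (a b : ℝ) (q : Plane) : ℝ :=
  (a * q 1 - b * q 0) / (a * q 0 + b * q 1)

/-- The coordinate `v` in the chart at `[a, b, 0]`. -/
noncomputable def chartV (a b : ℝ) (q : Plane) : ℝ :=
  (a ^ 2 + b ^ 2) / (a * q 0 + b * q 1)

/-- `p(γ) = [a, b, 0]`: going to infinity along `γ`, one converges to `[a, b, 0]` in the
projective plane. -/
def EndsAt (γ : Set Plane) (a b : ℝ) : Prop :=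
  (∀ᶠ q in alongEnd γ, a * q 0 + b * q 1 ≠ 0) ∧
    Tendsto (fun q => (chartU a b q, chartV a b q)) (alongEnd γ) (𝓝 (0, 0))

/-- The end `γ`, which converges to `p = [a, b, 0]`, is tangent at `p` to the line at infinity
`v = 0`: the slope `v / u` of the line joining `p` to a point of `γ` tends to `0`. -/
def EndTangentToInfinity (γ : Set Plane) (a b : ℝ) : Prop :=
  Asymptotics.IsLittleO (alongEnd γ) (chartV a b) (chartU a b)

/-- `c(γ) = c`, where `c` is in `ℝ ∪ {∞}` (a single point at infinity). -/
def EndValue (f : MvPolynomial (Fin 2) ℝ) (γ : Set Plane) (c : OnePoint ℝ) : Prop :=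
  Tendsto (fun q => (polyVal f q : OnePoint ℝ)) (alongEnd γ) (𝓝 c)

/-! ### The sums over the ends, computed outside the circle of radius `R`

The sums are taken in `[0, ∞]`, where every sum converges. -/

/-- `i_{p,c}^{abs}`: the sum of `|i(γ)|` over the ends `γ` with `p(γ) = p = [a, b, 0]` and
`c(γ) = c`. -/
noncomputable def absIndexAt (f : MvPolynomial (Fin 2) ℝ) (R a b : ℝ) (c : OnePoint ℝ) : ℝ≥0∞ :=
  ∑' γ : {γ : Set Plane // γ ∈ tangencyEnds f R ∧ EndsAt γ a b ∧ EndValue f γ c},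
    ENNReal.ofReal |endIndex f γ.1|

/-- `i_{p,c}^{T,abs}`: the part of `i_{p,c}^{abs}` that comes from the ends tangent at `p` to the
line at infinity. -/
noncomputable def absIndexTangentAt (f : MvPolynomial (Fin 2) ℝ) (R a b : ℝ) (c : OnePoint ℝ) :
    ℝ≥0∞ :=
  ∑' γ : {γ : Set Plane // γ ∈ tangencyEnds f R ∧ EndsAt γ a b ∧ EndValue f γ c ∧
      EndTangentToInfinity γ a b},
    ENNReal.ofReal |endIndex f γ.1|

/-- `i_{p,c}^{N,abs}`: the part of `i_{p,c}^{abs}` that comes from the ends not tangent at `p` to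
the line at infinity. -/
noncomputable def absIndexNormalAt (f : MvPolynomial (Fin 2) ℝ) (R a b : ℝ) (c : OnePoint ℝ) :
    ℝ≥0∞ :=
  ∑' γ : {γ : Set Plane // γ ∈ tangencyEnds f R ∧ EndsAt γ a b ∧ EndValue f γ c ∧
      ¬ EndTangentToInfinity γ a b},
    ENNReal.ofReal |endIndex f γ.1|

/-- `i_p^{abs}`, the sum of `i_{p,c}^{abs}` over `c` in `ℝ ∪ {∞}`. -/
noncomputable def absIndex (f : MvPolynomial (Fin 2) ℝ) (R a b : ℝ) : ℝ≥0∞ :=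
  ∑' c : OnePoint ℝ, absIndexAt f R a b c

/-- `i_p^{T,abs}`, the sum of `i_{p,c}^{T,abs}` over `c` in `ℝ ∪ {∞}`. -/
noncomputable def absIndexTangent (f : MvPolynomial (Fin 2) ℝ) (R a b : ℝ) : ℝ≥0∞ :=
  ∑' c : OnePoint ℝ, absIndexTangentAt f R a b c

/-- `i_p^{N,abs}`, the sum of `i_{p,c}^{N,abs}` over `c` in `ℝ ∪ {∞}`. -/
noncomputable def absIndexNormal (f : MvPolynomial (Fin 2) ℝ) (R a b : ℝ) : ℝ≥0∞ :=
  ∑' c : OnePoint ℝ, absIndexNormalAt f R a b c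

/-! ### The multiplicity `d_p` and the intersection number with the line at infinity -/

/-- `d_p` for `p = [a, b, 0]`: the multiplicity of the factor `b x - a y` in `f_d`, the homogeneous
term of highest degree of `f`. -/
noncomputable def multAtInfinity (f : MvPolynomial (Fin 2) ℝ) (a b : ℝ) : ℕ :=
  multiplicity (MvPolynomial.C b * MvPolynomial.X 0 - MvPolynomial.C a * MvPolynomial.X 1)
    (MvPolynomial.homogeneousComponent f.totalDegree f)

/-- The prime ideal of the polynomials that vanish at the point `P` of the affine plane. -/
noncomputable def pointIdeal {K : Type} [Field K] (P : Fin 2 → K) :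
    Ideal (MvPolynomial (Fin 2) K) :=
  RingHom.ker (MvPolynomial.eval P)

instance pointIdeal_isPrime {K : Type} [Field K] (P : Fin 2 → K) : (pointIdeal P).IsPrime :=
  RingHom.ker_isPrime (MvPolynomial.eval P)

/-- The local ring of the affine plane at `P`. -/
abbrev PlaneLocalRing {K : Type} [Field K] (P : Fin 2 → K) : Type :=
  Localization.AtPrime (pointIdeal P)

/-- The ideal generated by `G` and `H` in the local ring of the affine plane at `P`. -/
noncomputable def localIdeal {K : Type} [Field K] (G H : MvPolynomial (Fin 2) K)
    (P : Fin 2 → K) : Ideal (PlaneLocalRing P) :=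
  Ideal.span {algebraMap (MvPolynomial (Fin 2) K) (PlaneLocalRing P) G,
    algebraMap (MvPolynomial (Fin 2) K) (PlaneLocalRing P) H}

/-- The intersection number at `P` of the affine plane curves `G = 0` and `H = 0`: the dimension
over `K` of the local ring of the plane at `P` modulo `(G, H)` (possibly infinite). -/
noncomputable def planeIntersectionNumber {K : Type} [Field K] (G H : MvPolynomial (Fin 2) K)
    (P : Fin 2 → K) : ℕ∞ :=
  Cardinal.toENat (Module.rank K (PlaneLocalRing P ⧸ localIdeal G H P))

/-- The homogenization `Z ^ deg G * G (X / Z, Y / Z)`, the equation of the projective completion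
of the curve `G = 0`. -/
noncomputable def homogenized {K : Type} [Field K] (G : MvPolynomial (Fin 2) K) :
    MvPolynomial (Fin 3) K :=
  ∑ k ∈ Finset.range (G.totalDegree + 1),
    MvPolynomial.rename Fin.castSucc (MvPolynomial.homogeneousComponent k G) *
      MvPolynomial.X 2 ^ (G.totalDegree - k)

/-- The local equation at `[a, b, 0]` of the projective curve `A = 0`, in the chart
`(u, v) ↦ [a - b u, b + a u, v]` (a chart when `a ^ 2 + b ^ 2 ≠ 0`). -/
noncomputable def localEquation {K : Type} [Field K] (A : MvPolynomial (Fin 3) K) (a b : K) :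
    MvPolynomial (Fin 2) K :=
  MvPolynomial.aeval
    ![MvPolynomial.C a - MvPolynomial.C b * MvPolynomial.X 0,
      MvPolynomial.C b + MvPolynomial.C a * MvPolynomial.X 0,
      MvPolynomial.X 1] A

/-- The intersection number, at the point `[a, b, 0]` with `a`, `b` real, of the complexified
projective completion of the curve of tangencies of `f` with the complex line at infinity
`Z = 0`. -/
noncomputable def tangencyIntersectionNumber (f : MvPolynomial (Fin 2) ℝ) (a b : ℝ) : ℕ∞ :=
  planeIntersectionNumber
    (localEquation (homogenized (MvPolynomial.map (algebraMap ℝ ℂ) (tangencyPoly f)))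
      (a : ℂ) (b : ℂ))
    (localEquation (MvPolynomial.X 2 : MvPolynomial (Fin 3) ℂ) (a : ℂ) (b : ℂ))
    0

/-! ### Homogeneous polynomials -/

/-! Write `l = bX - aY`, `D = x ∂_y - y ∂_x` and `k = d_p - 1`. `D` is a derivation that preserves
degree. If `f_d = l ^ (k+1) g` with `g(a,b) ≠ 0`, then `D f_d = l ^ k ((k+1) (D l) g + l (D g))`,
and `D l` takes the value `-(a² + b²) ≠ 0` at `(a,b)`. So the leading form of the equation of the
curve of tangencies vanishes at `p` to order exactly `k` (`exists_leadingForm_tangencyPoly_eq`). In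
the chart at `p` the local equation `Q(u,v)` satisfies `Q(u,0) = u ^ k H(u)` with `H(0) ≠ 0`, and
the local ring modulo `(Q, v)` is `K[u]/(u ^ k)` (`planeIntersectionNumber_X_one`).

Since `|i(γ)| ≤ 1/2`, the inequalities follow from counting ends (`exists_forall_encard_ends_le`).
Let `μ ≤ k` be the multiplicity of `Q` at the origin, so that `Q(u,tu) = u ^ μ g(t,u)`, where
`g(τ,0) ≠ 0` for some slope `τ`. A line parallel to and near `v = τu` meets the curve near `p` at
most `μ` times. Each end at `p` crosses all such lines close enough to `v = τu` on at least one
side, so there are at most `2μ` ends. A line `v = tu` with `t` small meets the curve near `p`, apart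
from `p`, at most `k - μ` times, because `g(0,u) = u ^ (k-μ) H(u)`. A tangent end crosses all such
lines with `t` small enough and of at least one sign, so there are at most `2(k - μ)` tangent ends.
With `E` ends in all, `T` of them tangent, the weighted sum is at most `(E + T)/2 ≤ μ + (k - μ) =
k`.

One radius serves all `p`: there are finitely many real zeros of `f_d`, and all quantities are
independent of the representative `(a,b)` (the `_smul` lemmas). -/

open MvPolynomial in
theorem MvPolynomial.aeval_mul_left_of_isHomogeneous {σ R A : Type*} [CommSemiring R]
    [CommSemiring A] [Algebra R A] {g : MvPolynomial σ R} {n : ℕ} (hg : g.IsHomogeneous n)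
    (r : A) (p : σ → A) :
    aeval (fun i => r * p i) g = r ^ n * aeval p g := by
  simp only [aeval_def, eval₂_eq, Finset.mul_sum]
  refine Finset.sum_congr rfl fun d hd => ?_
  have h : d.degree = n := by
    have := hg (mem_support_iff.1 hd)
    rwa [Finsupp.degree_eq_weight_one]
  simp only [mul_pow, Finset.prod_mul_distrib, Finset.prod_pow_eq_pow_sum]
  rw [← h, Finsupp.degree_apply]
  ring

open MvPolynomial in
-- Only the component of `Q` of degree `n - m` contributes to the degree `n` part of the product.
theorem MvPolynomial.exists_isHomogeneous_factor {σ R : Type*} [CommSemiring R]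
    {P Q : MvPolynomial σ R} {m n : ℕ} (hP : P.IsHomogeneous m) (hPQ : (P * Q).IsHomogeneous n)
    (h0 : P * Q ≠ 0) : ∃ g j, g.IsHomogeneous j ∧ P * Q = P * g := by
  have key : P * Q = ∑ i ∈ Finset.range (Q.totalDegree + 1),
      if m + i = n then P * homogeneousComponent i Q else 0 := by
    conv_lhs => rw [← homogeneousComponent_eq_self hPQ]
    conv_lhs => rw [← sum_homogeneousComponent Q]
    rw [Finset.mul_sum, map_sum]
    refine Finset.sum_congr rfl fun i _ => ?_
    rw [homogeneousComponent_of_mem (hP.mul (homogeneousComponent_isHomogeneous i Q))]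
    simp only [eq_comm]
  by_cases hmn : m ≤ n
  · refine ⟨homogeneousComponent (n - m) Q, n - m, homogeneousComponent_isHomogeneous _ _, ?_⟩
    have h2 : ∀ i, (if m + i = n then P * homogeneousComponent i Q else 0) =
        if n - m = i then P * homogeneousComponent i Q else 0 := fun i =>
      if_congr (by omega) rfl rfl
    simp only [h2, Finset.sum_ite_eq] at key
    split_ifs at key with h
    · exact key
    · exact absurd key h0
  · refine absurd (key.trans (Finset.sum_eq_zero fun i _ => if_neg (by omega))) h0

open MvPolynomial in
-- Modulo `l = bX - aY`, the vector `(a² + b²)(X, Y)` equals `L (a, b)` with `L = aX + bY`.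
-- Homogeneity then gives `(a² + b²) ^ n g ≡ L ^ n g(a,b)`, and the right side is zero.
theorem MvPolynomial.dvd_of_isHomogeneous_of_eval_eq_zero {K : Type*} [Field K]
    {g : MvPolynomial (Fin 2) K} {n : ℕ} (hg : g.IsHomogeneous n) {a b : K}
    (hab : a ^ 2 + b ^ 2 ≠ 0) (h : eval ![a, b] g = 0) : C b * X 0 - C a * X 1 ∣ g := by
  set l : MvPolynomial (Fin 2) K := C b * X 0 - C a * X 1 with hl
  set L : MvPolynomial (Fin 2) K := C a * X 0 + C b * X 1 with hL
  set I := Ideal.span {l}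
  let q := Ideal.Quotient.mkₐ K I
  have hq : q l = 0 := Ideal.Quotient.eq_zero_iff_mem.2 (Ideal.mem_span_singleton_self l)
  have h1 : aeval (fun i => q (C (a ^ 2 + b ^ 2)) * q (X i)) g =
      aeval (fun i => q L * algebraMap K _ (![a, b] i)) g := by
    congr 2
    funext i
    have e : ∀ c : K, algebraMap K (MvPolynomial (Fin 2) K ⧸ I) c = q (C c) := fun c => rfl
    rw [e, ← map_mul, ← map_mul]
    fin_cases i
    · have : C (a ^ 2 + b ^ 2) * X 0 = L * C a + C b * l := by
        rw [hl, hL]; simp only [map_add, map_pow]; ring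
      simp only [Fin.zero_eta, Matrix.cons_val_zero]
      rw [this, map_add, map_mul q _ l, hq, mul_zero, add_zero]
    · have : C (a ^ 2 + b ^ 2) * X 1 = L * C b - C a * l := by
        rw [hl, hL]; simp only [map_add, map_pow]; ring
      simp only [Fin.mk_one, Matrix.cons_val_one]
      change q (C (a ^ 2 + b ^ 2) * X 1) = q (L * C b)
      rw [this, map_sub, map_mul q _ l, hq, mul_zero, sub_zero]
  rw [aeval_mul_left_of_isHomogeneous hg, aeval_mul_left_of_isHomogeneous hg] at h1
  have h2 : aeval (fun i => algebraMap K (MvPolynomial (Fin 2) K ⧸ I) (![a, b] i)) g = 0 := by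
    have := aeval_algebraMap_apply (MvPolynomial (Fin 2) K ⧸ I) ![a, b] g
    rw [Function.comp_def] at this
    rw [this, show aeval ![a, b] g = eval ![a, b] g by rw [← coe_aeval_eq_eval]; rfl, h, map_zero]
  have h3 : aeval (fun i => q (X i)) g = q g := by
    rw [← comp_aeval_apply]; simp
  rw [h2, h3, mul_zero, ← map_pow, ← map_mul] at h1
  have h4 := Ideal.mem_span_singleton.1 (Ideal.Quotient.eq_zero_iff_mem.1 h1)
  rw [← map_pow] at h4
  have hu : IsUnit (C ((a ^ 2 + b ^ 2) ^ n) : MvPolynomial (Fin 2) K) :=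
    (IsUnit.mk0 _ (pow_ne_zero _ hab)).map C
  exact (hu.dvd_mul_left).1 h4

open MvPolynomial in
theorem MvPolynomial.homogeneousComponent_map {σ R S : Type*} [CommSemiring R] [CommSemiring S]
    (φ : R →+* S) (n : ℕ) (p : MvPolynomial σ R) :
    homogeneousComponent n (map φ p) = map φ (homogeneousComponent n p) := by
  ext d
  simp only [coeff_homogeneousComponent, coeff_map]
  split_ifs <;> simp

/-! ### The leading form of the equation of the curve of tangencies -/

section LeadingForm

open MvPolynomial

theorem tangencyPoly_sum {ι : Type*} (s : Finset ι) (g : ι → MvPolynomial (Fin 2) ℝ) :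
    tangencyPoly (∑ i ∈ s, g i) = ∑ i ∈ s, tangencyPoly (g i) := by
  simp [tangencyPoly, Finset.mul_sum, Finset.sum_sub_distrib]

theorem tangencyPoly_mul (p q : MvPolynomial (Fin 2) ℝ) :
    tangencyPoly (p * q) = tangencyPoly p * q + p * tangencyPoly q := by
  simp only [tangencyPoly, Derivation.leibniz, smul_eq_mul]
  ring

theorem tangencyPoly_pow (p : MvPolynomial (Fin 2) ℝ) (n : ℕ) :
    tangencyPoly (p ^ (n + 1)) = (n + 1 : MvPolynomial (Fin 2) ℝ) * p ^ n * tangencyPoly p := by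
  simp only [tangencyPoly, Derivation.leibniz_pow, smul_eq_mul, nsmul_eq_mul, Nat.add_sub_cancel]
  push_cast
  ring

theorem tangencyPoly_isHomogeneous {g : MvPolynomial (Fin 2) ℝ} {n : ℕ}
    (hg : g.IsHomogeneous n) : (tangencyPoly g).IsHomogeneous n := by
  rcases n with _ | n
  -- Constants are separate: with truncated subtraction the degree count for `X i * pderiv j g`
  -- would give 1 instead of 0.
  · rw [totalDegree_eq_zero_iff_eq_C.1 ((totalDegree_zero_iff_isHomogeneous _).2 hg)]
    simpa [tangencyPoly] using isHomogeneous_zero _ _ _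
  · have h : ∀ i j : Fin 2, (X i * pderiv j g).IsHomogeneous (n + 1) := fun i j => by
      rw [add_comm]
      exact (isHomogeneous_X ℝ i).mul hg.pderiv
    exact (h 0 1).sub (h 1 0)

theorem tangencyPoly_eq_sum (f : MvPolynomial (Fin 2) ℝ) :
    tangencyPoly f = ∑ i ∈ Finset.range (f.totalDegree + 1),
      tangencyPoly (homogeneousComponent i f) := by
  conv_lhs => rw [← sum_homogeneousComponent f]
  exact tangencyPoly_sum _ _

/-- The operator `x ∂_y - y ∂_x` acts degree by degree, so the degree drops only if it kills the
leading form. -/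
theorem homogeneousComponent_totalDegree_tangencyPoly (f : MvPolynomial (Fin 2) ℝ)
    (h0 : tangencyPoly (homogeneousComponent f.totalDegree f) ≠ 0) :
    homogeneousComponent (tangencyPoly f).totalDegree (tangencyPoly f) =
      tangencyPoly (homogeneousComponent f.totalDegree f) := by
  have h1 : homogeneousComponent f.totalDegree (tangencyPoly f) =
      tangencyPoly (homogeneousComponent f.totalDegree f) := by
    rw [tangencyPoly_eq_sum f, map_sum]
    have h2 : ∀ i, homogeneousComponent f.totalDegree (tangencyPoly (homogeneousComponent i f)) =
        if f.totalDegree = i then tangencyPoly (homogeneousComponent i f) else 0 := fun i =>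
      homogeneousComponent_of_mem
        (tangencyPoly_isHomogeneous (homogeneousComponent_isHomogeneous i f))
    simp [h2]
  have h2 : (tangencyPoly f).totalDegree ≤ f.totalDegree := by
    rw [tangencyPoly_eq_sum f]
    refine totalDegree_finsetSum_le fun i hi => ?_
    exact (tangencyPoly_isHomogeneous (homogeneousComponent_isHomogeneous i f)).totalDegree_le.trans
      (Nat.lt_succ_iff.1 (Finset.mem_range.1 hi))
  have h3 : f.totalDegree ≤ (tangencyPoly f).totalDegree := by
    by_contra h
    exact h0 (h1 ▸ homogeneousComponent_eq_zero _ _ (not_le.1 h))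
  rw [h2.antisymm h3, h1]

theorem homogeneousComponent_totalDegree_ne_zero {f : MvPolynomial (Fin 2) ℝ} (hf : f ≠ 0) :
    homogeneousComponent f.totalDegree f ≠ 0 := by
  obtain ⟨d, hd, hdeg⟩ := Finset.exists_mem_eq_sup f.support (support_nonempty.2 hf)
    fun s => s.sum fun _ e => e
  intro h
  have h1 : coeff d (homogeneousComponent f.totalDegree f) = coeff d f := by
    rw [coeff_homogeneousComponent, if_pos]
    rw [totalDegree, hdeg]; rfl
  rw [h, coeff_zero] at h1
  exact mem_support_iff.1 hd h1.symm

theorem add_sq_ne_zero {a b : ℝ} (hab : (a, b) ≠ (0, 0)) : a ^ 2 + b ^ 2 ≠ 0 := by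
  contrapose! hab
  simp only [Prod.mk.injEq]
  constructor <;> nlinarith [sq_nonneg a, sq_nonneg b]

theorem exists_leadingForm_tangencyPoly_eq {f : MvPolynomial (Fin 2) ℝ} (hf : f ≠ 0) {a b : ℝ}
    (hab : (a, b) ≠ (0, 0)) (hm : 0 < multAtInfinity f a b) :
    ∃ h : MvPolynomial (Fin 2) ℝ,
      homogeneousComponent (tangencyPoly f).totalDegree (tangencyPoly f) =
      (C b * X 0 - C a * X 1) ^ (multAtInfinity f a b - 1) * h ∧ eval ![a, b] h ≠ 0 := by
  have hc := add_sq_ne_zero hab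
  obtain ⟨k, hk⟩ : ∃ k, multAtInfinity f a b = k + 1 := ⟨_, (Nat.succ_pred_eq_of_pos hm).symm⟩
  rw [hk, Nat.add_sub_cancel]
  set l : MvPolynomial (Fin 2) ℝ := C b * X 0 - C a * X 1 with hl
  set F := homogeneousComponent f.totalDegree f with hF
  have hF0 : F ≠ 0 := homogeneousComponent_totalDegree_ne_zero hf
  have hlh : l.IsHomogeneous 1 :=
    (isHomogeneous_C_mul_X b 0).sub (isHomogeneous_C_mul_X a 1)
  have hlu : ¬ IsUnit l := fun hu => by
    have := hu.map (eval ![a, b])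
    simp [hl, mul_comm] at this
  have hfin : FiniteMultiplicity l F := FiniteMultiplicity.of_not_isUnit hlu hF0
  obtain ⟨Q, hQ⟩ : l ^ (k + 1) ∣ F := by
    have := pow_multiplicity_dvd l F
    rwa [show multiplicity l F = k + 1 from hk] at this
  obtain ⟨g, j, hg, hPg⟩ := exists_isHomogeneous_factor (show (l ^ (k + 1)).IsHomogeneous (k + 1) by
    simpa using hlh.pow (k + 1)) (Q := Q) (n := f.totalDegree)
      (hQ ▸ homogeneousComponent_isHomogeneous _ _) (hQ ▸ hF0)
  rw [← hQ] at hPg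
  have hge : eval ![a, b] g ≠ 0 := fun h => by
    obtain ⟨r, hr⟩ := dvd_of_isHomogeneous_of_eval_eq_zero hg hc h
    refine hfin.not_pow_dvd_of_multiplicity_lt (m := k + 2) (by
      rw [show multiplicity l F = k + 1 from hk]; omega) ⟨r, ?_⟩
    rw [hPg, hr]; ring
  have hT : tangencyPoly F =
      l ^ k * ((k + 1 : MvPolynomial (Fin 2) ℝ) * tangencyPoly l * g + l * tangencyPoly g) := by
    rw [hPg, tangencyPoly_mul, tangencyPoly_pow]; ring
  have hev : eval ![a, b] ((k + 1 : MvPolynomial (Fin 2) ℝ) * tangencyPoly l * g +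
      l * tangencyPoly g) ≠ 0 := by
    have h1 : eval ![a, b] l = 0 := by simp [hl, mul_comm]
    have h2 : eval ![a, b] (tangencyPoly l) = -(a ^ 2 + b ^ 2) := by
      simp [hl, tangencyPoly, Derivation.leibniz, pderiv_X]
      ring
    rw [map_add, map_mul, map_mul, map_mul, h1, h2, zero_mul, add_zero]
    have h3 : eval ![a, b] (k + 1 : MvPolynomial (Fin 2) ℝ) ≠ 0 := by
      simp only [map_add, map_natCast, map_one]; positivity
    exact mul_ne_zero (mul_ne_zero h3 (neg_ne_zero.2 hc)) hge
  refine ⟨_, (homogeneousComponent_totalDegree_tangencyPoly f ?_).trans hT, hev⟩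
  change tangencyPoly F ≠ 0
  rw [hT]
  refine mul_ne_zero (pow_ne_zero _ fun h => ?_) fun h => hev (by rw [h, map_zero])
  exact hF0 (by rw [hPg, h]; simp)

end LeadingForm

/-! ### The local equation at a point at infinity -/

section LocalEquation

open MvPolynomial

theorem localEquation_X_two {K : Type} [Field K] (a b : K) :
    localEquation (X 2 : MvPolynomial (Fin 3) K) a b = X 1 := by
  simp [localEquation]

/-- Setting `v = 0` kills every term of the homogenization except the leading form, and `bX - aY`
becomes `-(a² + b²) u` at `(a - bu, b + au)`. -/
theorem aeval_localEquation_homogenized {K : Type} [Field K] {G h : MvPolynomial (Fin 2) K}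
    {a b : K} {k : ℕ} (hab : a ^ 2 + b ^ 2 ≠ 0)
    (hG : homogeneousComponent G.totalDegree G = (C b * X 0 - C a * X 1) ^ k * h)
    (hh : eval ![a, b] h ≠ 0) :
    ∃ H : Polynomial K, aeval ![Polynomial.X, 0] (localEquation (homogenized G) a b) =
      Polynomial.X ^ k * H ∧ H.eval 0 ≠ 0 := by
  let w : Fin 2 → Polynomial K := ![Polynomial.C a - Polynomial.C b * Polynomial.X,
    Polynomial.C b + Polynomial.C a * Polynomial.X]
  have h1 : ∀ A : MvPolynomial (Fin 3) K, aeval ![Polynomial.X, 0] (localEquation A a b) =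
      aeval ![w 0, w 1, (0 : Polynomial K)] A := fun A => by
    rw [localEquation, ← AlgHom.comp_apply, comp_aeval]
    congr 2
    funext i
    fin_cases i <;> simp [w]
  have h2 : aeval ![Polynomial.X, 0] (localEquation (homogenized G) a b) =
      aeval w (homogeneousComponent G.totalDegree G) := by
    rw [h1, homogenized, map_sum, Finset.sum_range_succ, Finset.sum_eq_zero, zero_add]
    · rw [map_mul, Nat.sub_self, pow_zero, map_one, mul_one, aeval_rename]
      congr 2
      funext i
      fin_cases i <;> simp
    · intro i hi
      have := Finset.mem_range.1 hi
      simp [show G.totalDegree - i ≠ 0 by omega]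
  have h3 : aeval w (C b * X 0 - C a * X 1) =
      Polynomial.C (-(a ^ 2 + b ^ 2)) * Polynomial.X := by
    simp only [map_sub, map_mul, aeval_C, aeval_X, w, Matrix.cons_val_zero, Matrix.cons_val_one,
      Polynomial.algebraMap_eq, map_neg, map_add, map_pow]
    ring
  have h4 : Polynomial.eval 0 (aeval w h) = eval ![a, b] h := by
    rw [← Polynomial.coe_aeval_eq_eval, ← coe_aeval_eq_eval]
    change (Polynomial.aeval 0) (aeval w h) = aeval ![a, b] h
    rw [← AlgHom.comp_apply, comp_aeval]
    congr 2
    funext i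
    fin_cases i <;> simp [w]
  refine ⟨Polynomial.C (-(a ^ 2 + b ^ 2)) ^ k * aeval w h, ?_, ?_⟩
  · rw [h2, hG, map_mul, map_pow, h3]; ring
  · rw [Polynomial.eval_mul, h4]
    refine mul_ne_zero ?_ hh
    rw [Polynomial.eval_pow, Polynomial.eval_C]
    exact pow_ne_zero _ (neg_ne_zero.2 hab)

/-- Modulo `v`, reduction and `A ↦ A(u,0)` are algebra maps that agree on the two generators. -/
theorem sub_aeval_mem_span_X_one {K : Type} [Field K] (A : MvPolynomial (Fin 2) K) :
    X 1 ∣ A - Polynomial.aeval (X 0) (aeval ![(Polynomial.X : Polynomial K), 0] A) := by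
  rw [← Ideal.mem_span_singleton, ← Ideal.Quotient.eq_zero_iff_mem]
  have : (Ideal.Quotient.mkₐ K (Ideal.span {(X 1 : MvPolynomial (Fin 2) K)})) =
      ((Ideal.Quotient.mkₐ K (Ideal.span {(X 1 : MvPolynomial (Fin 2) K)})).comp
        (Polynomial.aeval (X 0))).comp (aeval ![(Polynomial.X : Polynomial K), 0]) := by
    ext i
    fin_cases i
    · simp
    · simp
  have h := DFunLike.congr_fun this A
  simp only [AlgHom.comp_apply] at h
  rw [map_sub, sub_eq_zero]
  exact h

/-- The localization map from the coordinate ring of the plane to its local ring at the origin. -/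
noncomputable abbrev toLocalRing (K : Type) [Field K] :
    MvPolynomial (Fin 2) K →+* PlaneLocalRing (0 : Fin 2 → K) :=
  algebraMap _ _

/-- The map `A ↦ A(u,0) mod u ^ k` turns polynomials not vanishing at the origin into units, hence
extends to the local ring. It is surjective. Its kernel is generated by `v` and `u ^ k`, and `Q` may
replace `u ^ k` because `H` is a unit at the origin. -/
theorem planeIntersectionNumber_X_one {K : Type} [Field K] {Q : MvPolynomial (Fin 2) K} {k : ℕ}
    {H : Polynomial K} (hQ : aeval ![Polynomial.X, 0] Q = Polynomial.X ^ k * H)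
    (hH : H.eval 0 ≠ 0) : planeIntersectionNumber Q (X 1) 0 = k := by
  let J : Ideal (Polynomial K) := Ideal.span {Polynomial.X ^ k}
  let ρ : MvPolynomial (Fin 2) K →ₐ[K] Polynomial K := aeval ![Polynomial.X, 0]
  have hunit : ∀ p : Polynomial K, p.eval 0 ≠ 0 → IsUnit (Ideal.Quotient.mkₐ K J p) := by
    intro p hp
    have hcop : IsCoprime p (Polynomial.X ^ k) := by
      refine IsCoprime.pow_right (IsCoprime.symm ?_)
      refine (Polynomial.irreducible_X.coprime_iff_not_dvd).2 fun hd => hp ?_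
      rw [← Polynomial.coeff_zero_eq_eval_zero]
      exact Polynomial.X_dvd_iff.1 hd
    obtain ⟨r, s, hrs⟩ := hcop
    refine IsUnit.of_mul_eq_one (Ideal.Quotient.mkₐ K J r) ?_
    rw [← map_mul, ← map_one (Ideal.Quotient.mkₐ K J), ← sub_eq_zero, ← map_sub]
    refine Ideal.Quotient.eq_zero_iff_mem.2 (Ideal.mem_span_singleton.2 ⟨-s, ?_⟩)
    rw [← hrs]; ring
  have hρ0 : ∀ A, (ρ A).eval 0 = eval 0 A := fun A => by
    rw [← Polynomial.coe_aeval_eq_eval, ← coe_aeval_eq_eval]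
    change (Polynomial.aeval 0) (aeval _ A) = aeval 0 A
    rw [← AlgHom.comp_apply, comp_aeval]
    congr 2
    funext i
    fin_cases i <;> simp
  let σ : MvPolynomial (Fin 2) K →ₐ[K] Polynomial K ⧸ J := (Ideal.Quotient.mkₐ K J).comp ρ
  have hσ : ∀ y : (pointIdeal (0 : Fin 2 → K)).primeCompl, IsUnit (σ y) := fun y =>
    hunit (ρ y) (by rw [hρ0]; exact y.2)
  let τ : PlaneLocalRing (0 : Fin 2 → K) →ₐ[K] Polynomial K ⧸ J := IsLocalization.liftAlgHom hσ
  have hτ : ∀ A, τ (toLocalRing K A) = σ A := fun A => IsLocalization.lift_eq _ A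
  have hsurj : Function.Surjective τ := fun x => by
    obtain ⟨p, rfl⟩ := Ideal.Quotient.mk_surjective x
    refine ⟨toLocalRing K (Polynomial.aeval (X 0) p), ?_⟩
    rw [hτ]
    change Ideal.Quotient.mk J (ρ (Polynomial.aeval (X 0) p)) = _
    congr 1
    rw [← Polynomial.aeval_algHom_apply]
    simp [ρ]
  have hker : RingHom.ker τ = localIdeal Q (X 1) 0 := by
    refine le_antisymm (fun x hx => ?_) ?_
    · obtain ⟨A, s, rfl⟩ := IsLocalization.exists_mk'_eq (pointIdeal (0 : Fin 2 → K)).primeCompl x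
      have hX1 : toLocalRing K (X 1) ∈ localIdeal Q (X 1) 0 :=
        Ideal.subset_span (by simp)
      have hQm : toLocalRing K Q ∈ localIdeal Q (X 1) 0 :=
        Ideal.subset_span (by simp)
      have hmod : ∀ B : MvPolynomial (Fin 2) K,
          toLocalRing K B ∈ localIdeal Q (X 1) 0 ↔
          toLocalRing K (Polynomial.aeval (X 0) (ρ B)) ∈
            localIdeal Q (X 1) 0 := fun B => by
        obtain ⟨D, hD⟩ := sub_aeval_mem_span_X_one B
        have : toLocalRing K B =
            toLocalRing K (Polynomial.aeval (X 0) (ρ B)) +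
              toLocalRing K (X 1) * toLocalRing K D := by
          rw [← map_mul, ← hD, ← map_add]; congr 1; ring
        rw [this]
        exact Ideal.add_mem_iff_left _ (Ideal.mul_mem_right _ _ hX1)
      have hXk : toLocalRing K (X 0 ^ k) ∈
          localIdeal Q (X 1) 0 := by
        have h1 := (hmod Q).1 hQm
        rw [show ρ Q = _ from hQ, map_mul, map_pow, Polynomial.aeval_X, map_mul] at h1
        refine (Ideal.mul_unit_mem_iff_mem _ ?_).1 h1
        refine IsLocalization.map_units (PlaneLocalRing (0 : Fin 2 → K))
          (⟨Polynomial.aeval (X 0) H, fun h => hH ?_⟩ :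
            (pointIdeal (0 : Fin 2 → K)).primeCompl)
        have h2 : eval 0 (Polynomial.aeval (X 0 : MvPolynomial (Fin 2) K) H) = 0 := h
        rw [← hρ0, ← Polynomial.aeval_algHom_apply] at h2
        simpa [ρ] using h2
      have hA : σ A = 0 := by
        have h1 : τ (IsLocalization.mk' _ A s) = 0 := hx
        rw [← hτ, ← IsLocalization.mk'_spec (PlaneLocalRing (0 : Fin 2 → K)) A s, map_mul, h1,
          zero_mul]
      obtain ⟨p, hp⟩ := Ideal.mem_span_singleton.1 (Ideal.Quotient.eq_zero_iff_mem.1 hA)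
      have hA2 : toLocalRing K A ∈ localIdeal Q (X 1) 0 := by
        rw [hmod, show ρ A = _ from hp, map_mul, map_pow, Polynomial.aeval_X, map_mul]
        exact Ideal.mul_mem_right _ _ hXk
      rw [← IsLocalization.mk'_spec (PlaneLocalRing (0 : Fin 2 → K)) A s] at hA2
      exact (Ideal.mul_unit_mem_iff_mem _ (IsLocalization.map_units _ s)).1 hA2
    · refine Ideal.span_le.2 ?_
      rintro _ (rfl | rfl)
      · change τ _ = 0
        rw [hτ]
        refine Ideal.Quotient.eq_zero_iff_mem.2 (Ideal.mem_span_singleton.2 ⟨H, hQ⟩)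
      · change τ _ = 0
        rw [hτ]
        change Ideal.Quotient.mk J (ρ (X 1)) = 0
        simp [ρ]
  have e : (PlaneLocalRing (0 : Fin 2 → K) ⧸ localIdeal Q (X 1) 0) ≃ₐ[K] (Polynomial K ⧸ J) :=
    (Ideal.quotientEquivAlgOfEq K hker.symm).trans
      (Ideal.quotientKerAlgEquivOfSurjective hsurj)
  have hfr : Module.finrank K (Polynomial K ⧸ J) = k := by
    rw [finrank_quotient_span_eq_natDegree, Polynomial.natDegree_X_pow]
  have hfin : Module.Finite K (Polynomial K ⧸ J) :=
    (Polynomial.monic_X_pow k).finite_quotient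
  rw [planeIntersectionNumber, e.toLinearEquiv.rank_eq, ← Module.finrank_eq_rank, hfr]
  simp

theorem tangencyIntersectionNumber_eq {f : MvPolynomial (Fin 2) ℝ} (hf : f ≠ 0) {a b : ℝ}
    (hab : (a, b) ≠ (0, 0)) (hm : 0 < multAtInfinity f a b) :
    tangencyIntersectionNumber f a b = ((multAtInfinity f a b - 1 : ℕ) : ℕ∞) := by
  obtain ⟨h, hh, hev⟩ := exists_leadingForm_tangencyPoly_eq hf hab hm
  have hinj : Function.Injective (algebraMap ℝ ℂ) := (algebraMap ℝ ℂ).injective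
  have h1 : homogeneousComponent (map (algebraMap ℝ ℂ) (tangencyPoly f)).totalDegree
      (map (algebraMap ℝ ℂ) (tangencyPoly f)) =
      (C (b : ℂ) * X 0 - C (a : ℂ) * X 1) ^ (multAtInfinity f a b - 1) *
        map (algebraMap ℝ ℂ) h := by
    have hdeg : (map (algebraMap ℝ ℂ) (tangencyPoly f)).totalDegree =
        (tangencyPoly f).totalDegree := by
      rw [totalDegree, totalDegree, support_map_of_injective _ hinj]
    rw [hdeg, homogeneousComponent_map, hh]
    simp
  have hc : (a : ℂ) ^ 2 + (b : ℂ) ^ 2 ≠ 0 := by exact_mod_cast add_sq_ne_zero hab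
  have h2 : eval ![(a : ℂ), (b : ℂ)] (map (algebraMap ℝ ℂ) h) ≠ 0 := by
    rw [eval_map, show (![(a : ℂ), (b : ℂ)] : Fin 2 → ℂ) = algebraMap ℝ ℂ ∘ ![a, b] by
      funext i; fin_cases i <;> rfl, ← eval₂_comp]
    simpa using hev
  obtain ⟨H, hH, hH0⟩ := aeval_localEquation_homogenized hc h1 h2
  rw [tangencyIntersectionNumber, localEquation_X_two]
  exact planeIntersectionNumber_X_one hH hH0

end LocalEquation

/-! ### Real roots of a family of polynomials in one variable -/

section Roots

open Polynomial

/-- Iterated Rolle theorem for polynomials. -/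
theorem exists_iterate_derivative_eval_eq_zero {a b : ℝ} (n : ℕ) :
    ∀ (p : ℝ[X]) (s : Finset ℝ), n < s.card → (∀ x ∈ s, x ∈ Set.Ioo a b ∧ p.eval x = 0) →
      ∃ c ∈ Set.Ioo a b, (derivative^[n] p).eval c = 0 := by
  induction n with
  | zero =>
    intro p s hs h
    obtain ⟨x, hx⟩ := Finset.card_pos.1 hs
    exact ⟨x, (h x hx).1, (h x hx).2⟩
  | succ n ih =>
    intro p s hs h
    obtain ⟨t, hts, ht⟩ := Finset.exists_subset_card_eq (Nat.succ_le_of_lt hs)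
    let e := t.orderEmbOfFin ht
    have he : ∀ i, e i ∈ Set.Ioo a b ∧ p.eval (e i) = 0 := fun i =>
      h _ (hts (t.orderEmbOfFin_mem ht i))
    have hroot : ∀ i : Fin (n + 1), ∃ c ∈ Set.Ioo (e i.castSucc) (e i.succ),
        p.derivative.eval c = 0 := fun i => by
      obtain ⟨c, hc, hc0⟩ := exists_deriv_eq_zero (f := fun x => p.eval x)
        (e.strictMono i.castSucc_lt_succ) p.continuous.continuousOn
        ((he i.castSucc).2.trans (he i.succ).2.symm)
      exact ⟨c, hc, by rwa [Polynomial.deriv] at hc0⟩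
    choose c hc hc0 using hroot
    have hmono : StrictMono c := Fin.strictMono_iff_lt_succ.2 fun i => by
      have h1 := (hc i.castSucc).2
      have h2 := (hc i.succ).1
      rw [Fin.succ_castSucc] at h1
      exact h1.trans h2
    obtain ⟨x, hx, hx0⟩ := ih p.derivative (Finset.univ.image c)
      (by rw [Finset.card_image_of_injective _ hmono.injective]; simp) (by
        intro y hy
        obtain ⟨i, -, rfl⟩ := Finset.mem_image.1 hy
        exact ⟨⟨(he i.castSucc).1.1.trans (hc i).1, (hc i).2.trans (he i.succ).1.2⟩, hc0 i⟩)
    exact ⟨x, hx, by rwa [Function.iterate_succ_apply]⟩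

/-- In `ℝ[X][X]` the inner variable is the parameter `t` of a family and the outer one is the
unknown `s`. -/
theorem evalEval_eq_eval_map (P : ℝ[X][X]) (t s : ℝ) :
    P.evalEval t s = (P.map (evalRingHom t)).eval s := by
  rw [← coe_evalEvalRingHom, eval_map, evalEvalRingHom_eq, coe_eval₂RingHom]

theorem continuous_evalEval (P : ℝ[X][X]) :
    Continuous fun x : ℝ × ℝ => P.evalEval x.1 x.2 := by
  simp only [evalEval_eq_eval_map, eval_map, eval₂_eq_sum_range, coe_evalRingHom]
  refine continuous_finsetSum _ fun i _ => ?_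
  exact ((P.coeff i).continuous.comp continuous_fst).mul (continuous_snd.pow i)

theorem exists_forall_evalEval_ne_zero (P : ℝ[X][X]) {t s : ℝ} (h : P.evalEval t s ≠ 0) :
    ∃ ε > 0, ∀ t' s', |t' - t| < ε → |s' - s| < ε → P.evalEval t' s' ≠ 0 := by
  have h1 : ∀ᶠ x : ℝ × ℝ in 𝓝 (t, s), P.evalEval x.1 x.2 ≠ 0 :=
    (continuous_evalEval P).continuousAt.eventually_ne h
  obtain ⟨ε, hε, h2⟩ := Metric.eventually_nhds_iff.1 h1
  refine ⟨ε, hε, fun t' s' ht hs => h2 (y := (t', s')) ?_⟩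
  rw [Prod.dist_eq]
  exact max_lt ht hs

/-- If the coefficient of degree `n` of a family of polynomials does not vanish at `t = 0`, then
the members of the family with small `t` have at most `n` small real roots. -/
theorem exists_forall_card_roots_le (P : ℝ[X][X]) (n : ℕ) (h : (P.coeff n).eval 0 ≠ 0) :
    ∃ ε > 0, ∀ t, |t| < ε → ∀ A : Finset ℝ, (∀ s ∈ A, |s| < ε ∧ P.evalEval t s = 0) →
      A.card ≤ n := by
  -- The `n`-th derivative in `s` at the origin is `n!` times the given coefficient. By continuity
  -- it has no zero nearby, whereas `n + 1` small roots would produce one by Rolle.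
  have h0 : (derivative^[n] P).evalEval 0 0 ≠ 0 := by
    rw [evalEval_eq_eval_map, ← coeff_zero_eq_eval_zero, coeff_map, coeff_iterate_derivative,
      zero_add, Nat.descFactorial_self]
    simpa [Nat.factorial_ne_zero] using h
  obtain ⟨ε, hε, hne⟩ := exists_forall_evalEval_ne_zero _ h0
  refine ⟨ε, hε, fun t ht A hA => ?_⟩
  by_contra hcard
  obtain ⟨c, hc, hc0⟩ := exists_iterate_derivative_eval_eq_zero (a := -ε) (b := ε) n
    (P.map (evalRingHom t)) A (not_le.1 hcard) fun s hs =>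
      ⟨abs_lt.1 (hA s hs).1, by rw [← evalEval_eq_eval_map]; exact (hA s hs).2⟩
  refine hne t c (by simpa using ht) (by simpa using abs_lt.2 hc) ?_
  rwa [evalEval_eq_eval_map, ← iterate_derivative_map]

theorem map_evalRingHom_aeval (w : Fin 2 → ℝ[X][X]) (t : ℝ) (Q : MvPolynomial (Fin 2) ℝ) :
    (MvPolynomial.aeval w Q).map (evalRingHom t) =
      MvPolynomial.aeval (fun i => (w i).map (evalRingHom t)) Q := by
  induction Q using MvPolynomial.induction_on with
  | C r =>
    rw [MvPolynomial.aeval_C, MvPolynomial.aeval_C]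
    simp [Polynomial.algebraMap_apply]
  | add p q hp hq => simp [hp, hq]
  | mul_X p i hp => simp [hp]

theorem evalEval_aeval (w : Fin 2 → ℝ[X][X]) (t s : ℝ) (Q : MvPolynomial (Fin 2) ℝ) :
    (MvPolynomial.aeval w Q).evalEval t s =
      MvPolynomial.eval (fun i => (w i).evalEval t s) Q := by
  induction Q using MvPolynomial.induction_on with
  | C r =>
    rw [MvPolynomial.aeval_C, MvPolynomial.eval_C]
    simp [Polynomial.algebraMap_apply]
  | add p q hp hq => simp [hp, hq]
  | mul_X p i hp => simp [hp]

end Roots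

/-! ### Counting connected sets on which a function is unbounded -/

section Counting

variable {X : Type*} [TopologicalSpace X]

open Classical in
-- By the intermediate value theorem, any `n + 1` of the sets would all cross one common high level,
-- in distinct points because they are disjoint.
theorem encard_le_of_forall_level_card_le {S : Set (Set X)} (hd : S.PairwiseDisjoint id)
    (hc : ∀ γ ∈ S, IsPreconnected γ) {φ : X → ℝ} (hφ : ∀ γ ∈ S, ContinuousOn φ γ)
    (hunb : ∀ γ ∈ S, ∀ M, ∃ q ∈ γ, M ≤ φ q) {n : ℕ} {M₀ : ℝ}
    (h : ∀ M, M₀ ≤ M → ∀ A : Finset X, (∀ q ∈ A, (∃ γ ∈ S, q ∈ γ) ∧ φ q = M) → A.card ≤ n) :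
    S.encard ≤ n := by
  by_contra hcon
  have h1 : ((n + 1 : ℕ) : ℕ∞) ≤ S.encard := by
    push_cast
    exact Order.add_one_le_of_lt (not_le.1 hcon)
  obtain ⟨T, hTS, hT⟩ := Set.exists_subset_encard_eq h1
  have hfin : T.Finite := Set.finite_of_encard_eq_coe hT
  have : Nonempty X := by
    obtain ⟨γ, hγ⟩ : T.Nonempty := Set.encard_ne_zero.1 (by rw [hT]; simp)
    exact ⟨(hunb γ (hTS hγ) 0).choose⟩
  have hq0 : ∀ γ ∈ T, ∃ q ∈ γ, M₀ ≤ φ q := fun γ hγ => hunb γ (hTS hγ) M₀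
  choose! q₀ hq₀ hq₀' using hq0
  obtain ⟨M₁, hM₁⟩ := (hfin.image fun γ => φ (q₀ γ)).bddAbove
  set M := max M₀ M₁
  have hq : ∀ γ ∈ T, ∃ q ∈ γ, φ q = M := fun γ hγ => by
    obtain ⟨q, hq, hMq⟩ := hunb γ (hTS hγ) M
    exact (hc γ (hTS hγ)).intermediate_value (hq₀ γ hγ) hq (hφ γ (hTS hγ))
      ⟨(hM₁ (Set.mem_image_of_mem _ hγ)).trans (le_max_right _ _), hMq⟩
  choose! q hqm hqM using hq
  have hinj : Set.InjOn q T := fun γ hγ γ' hγ' heq => by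
    by_contra hne
    exact Set.disjoint_left.1 (hd (hTS hγ) (hTS hγ') hne) (hqm γ hγ) (heq ▸ hqm γ' hγ')
  have hcard := h M (le_max_left _ _) (hfin.toFinset.image q) (by
    intro y hy
    obtain ⟨γ, hγ, rfl⟩ := Finset.mem_image.1 hy
    rw [Set.Finite.mem_toFinset] at hγ
    exact ⟨⟨γ, hTS hγ, hqm γ hγ⟩, hqM γ hγ⟩)
  rw [Finset.card_image_of_injOn (by simpa using hinj)] at hcard
  rw [hfin.encard_eq_coe_toFinset_card] at hT
  have : hfin.toFinset.card = n + 1 := by exact_mod_cast hT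
  omega

/-- If `|φ|` is unbounded on a set, `φ` is unbounded above or below there; each case allows at most
`n` sets. -/
theorem encard_le_two_mul_of_forall_level_card_le {S : Set (Set X)} (hd : S.PairwiseDisjoint id)
    (hc : ∀ γ ∈ S, IsPreconnected γ) {φ : X → ℝ} (hφ : ∀ γ ∈ S, ContinuousOn φ γ)
    (hunb : ∀ γ ∈ S, ∀ M, ∃ q ∈ γ, M ≤ |φ q|) {n : ℕ} {M₀ : ℝ}
    (h : ∀ M, M₀ ≤ |M| → ∀ A : Finset X, (∀ q ∈ A, (∃ γ ∈ S, q ∈ γ) ∧ φ q = M) → A.card ≤ n) :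
    S.encard ≤ 2 * n := by
  set S₁ := {γ ∈ S | ∀ M, ∃ q ∈ γ, M ≤ φ q}
  set S₂ := {γ ∈ S | ∀ M, ∃ q ∈ γ, M ≤ -φ q}
  have hS : S ⊆ S₁ ∪ S₂ := fun γ hγ => by
    by_contra hcon
    simp only [S₁, S₂, Set.mem_union, Set.mem_ofPred_eq, hγ, true_and] at hcon
    push Not at hcon
    obtain ⟨⟨M₁, h₁⟩, M₂, h₂⟩ := hcon
    obtain ⟨q, hq, hM⟩ := hunb γ hγ (max M₁ M₂)
    rcases le_abs'.1 hM with h3 | h3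
    · linarith [h₂ q hq, le_max_right M₁ M₂]
    · linarith [h₁ q hq, le_max_left M₁ M₂]
  have h₁ : S₁.encard ≤ n := encard_le_of_forall_level_card_le (φ := φ) (M₀ := M₀)
    (hd.subset fun _ h => h.1) (fun γ hγ => hc γ hγ.1) (fun γ hγ => hφ γ hγ.1)
    (fun γ hγ => hγ.2) fun M hM A hA => h M (hM.trans (le_abs_self M)) A fun q hq =>
      ⟨(hA q hq).1.imp fun γ hγ => ⟨hγ.1.1, hγ.2⟩, (hA q hq).2⟩
  have h₂ : S₂.encard ≤ n := encard_le_of_forall_level_card_le (φ := fun q => -φ q) (M₀ := M₀)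
    (hd.subset fun _ h => h.1) (fun γ hγ => hc γ hγ.1) (fun γ hγ => (hφ γ hγ.1).neg)
    (fun γ hγ => hγ.2) fun M hM A hA =>
      h (-M) (by rw [abs_neg]; exact hM.trans (le_abs_self M)) A fun q hq =>
        ⟨(hA q hq).1.imp fun γ hγ => ⟨hγ.1.1, hγ.2⟩, by linarith [(hA q hq).2]⟩
  calc S.encard ≤ (S₁ ∪ S₂).encard := Set.encard_le_encard hS
    _ ≤ S₁.encard + S₂.encard := Set.encard_union_le _ _
    _ ≤ n + n := add_le_add h₁ h₂
    _ = 2 * n := (two_mul _).symm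

end Counting

/-! ### Ends of the curve of tangencies near a point at infinity -/

theorem alongEnd_neBot {γ : Set Plane} (h : ¬ Bornology.IsBounded γ) : (alongEnd γ).NeBot := by
  rw [alongEnd, neBot_iff, Ne, inf_principal_eq_bot]
  exact h

theorem pairwiseDisjoint_tangencyEnds (f : MvPolynomial (Fin 2) ℝ) (R : ℝ) :
    (tangencyEnds f R).PairwiseDisjoint id := by
  rintro _ ⟨⟨q, -, rfl⟩, -⟩ _ ⟨⟨q', -, rfl⟩, -⟩ hne
  refine Set.disjoint_left.2 fun x hx hx' => hne ?_
  exact (connectedComponentIn_eq hx).trans (connectedComponentIn_eq hx').symm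

/-! ### The affine chart at a point at infinity -/

section Chart

variable {a b : ℝ}

theorem chartV_ne_zero (hab : (a, b) ≠ (0, 0)) {q : Plane} (hq : a * q 0 + b * q 1 ≠ 0) :
    chartV a b q ≠ 0 :=
  div_ne_zero (add_sq_ne_zero hab) hq

theorem chart_injective (hab : (a, b) ≠ (0, 0)) {q q' : Plane} (hq : a * q 0 + b * q 1 ≠ 0)
    (hq' : a * q' 0 + b * q' 1 ≠ 0) (hU : chartU a b q = chartU a b q')
    (hV : chartV a b q = chartV a b q') : q = q' := by
  have hc := add_sq_ne_zero hab
  have h1 : a * q 0 + b * q 1 = a * q' 0 + b * q' 1 := by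
    rw [chartV, chartV, div_eq_div_iff hq hq'] at hV
    exact (mul_left_cancel₀ hc hV).symm
  have h2 : a * q 1 - b * q 0 = a * q' 1 - b * q' 0 := by
    rw [chartU, chartU, h1] at hU
    exact (div_left_inj' hq').1 hU
  ext i
  refine mul_left_cancel₀ hc ?_
  fin_cases i
  · simp only [Fin.zero_eta]; linear_combination a * h1 - b * h2
  · simp only [Fin.mk_one]; linear_combination b * h1 + a * h2

theorem continuousOn_chartU {s : Set Plane} (hs : ∀ q ∈ s, a * q 0 + b * q 1 ≠ 0) :
    ContinuousOn (chartU a b) s := by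
  unfold chartU
  exact ContinuousOn.div (by fun_prop) (by fun_prop) hs

theorem continuousOn_chartV {s : Set Plane} (hs : ∀ q ∈ s, a * q 0 + b * q 1 ≠ 0) :
    ContinuousOn (chartV a b) s := by
  unfold chartV
  exact ContinuousOn.div (by fun_prop) (by fun_prop) hs

open MvPolynomial in
-- The representative `(a - bu, b + au, v)` is `v` times `(x, y, 1)`, and the homogenization is
-- homogeneous of degree `deg G`.
theorem eval_localEquation_homogenized (G : MvPolynomial (Fin 2) ℝ) {q : Plane}
    (hq : a * q 0 + b * q 1 ≠ 0) :
    eval ![chartU a b q, chartV a b q] (localEquation (homogenized G) a b) =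
      chartV a b q ^ G.totalDegree * polyVal G q := by
  set V := chartV a b q with hV
  have h0 : a - b * chartU a b q = V * q 0 := by
    rw [hV, chartU, chartV]; field_simp; ring
  have h1 : b + a * chartU a b q = V * q 1 := by
    rw [hV, chartU, chartV]; field_simp; ring
  have h2 : eval ![chartU a b q, V] (localEquation (homogenized G) a b) =
      eval ![V * q 0, V * q 1, V] (homogenized G) := by
    rw [localEquation, ← coe_aeval_eq_eval, ← coe_aeval_eq_eval]
    change aeval _ (aeval _ _) = aeval _ _
    rw [← AlgHom.comp_apply, comp_aeval]
    congr 2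
    funext i
    fin_cases i <;> simp [h0, h1]
  rw [h2, polyVal]
  have hsum : eval (fun i => q i) G = ∑ k ∈ Finset.range (G.totalDegree + 1),
      eval (fun i => q i) (homogeneousComponent k G) := by
    rw [← map_sum, sum_homogeneousComponent]
  rw [homogenized, map_sum, hsum, Finset.mul_sum]
  refine Finset.sum_congr rfl fun i hi => ?_
  have h3 : eval ![V * q 0, V * q 1, V] (rename Fin.castSucc (homogeneousComponent i G)) =
      V ^ i * eval (fun i => q i) (homogeneousComponent i G) := by
    have := aeval_mul_left_of_isHomogeneous (homogeneousComponent_isHomogeneous i G) V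
      (fun i => q i)
    rw [eval_rename]
    have hfun : (![V * q 0, V * q 1, V] ∘ Fin.castSucc : Fin 2 → ℝ) = fun i => V * q i := by
      funext j
      fin_cases j <;> simp
    rw [hfun]
    exact this
  rw [map_mul, h3, map_pow, eval_X]
  have hi' := Finset.mem_range.1 hi
  rw [show V ^ G.totalDegree = V ^ i * V ^ (G.totalDegree - i) by
    rw [← pow_add]; congr 1; omega]
  simp only [Matrix.cons_val]
  ring

theorem norm_sq_eq_chart (q : Plane) : (a ^ 2 + b ^ 2) * ‖q‖ ^ 2 =
    (a * q 0 + b * q 1) ^ 2 + (a * q 1 - b * q 0) ^ 2 := by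
  rw [EuclideanSpace.real_norm_sq_eq, Fin.sum_univ_two]
  ring

/-- Outside a large disc, an end that converges to `[a, b, 0]` lies in a small neighbourhood of
this point. -/
theorem exists_forall_end_subset_chart {f : MvPolynomial (Fin 2) ℝ} (hab : (a, b) ≠ (0, 0))
    {k : ℕ} {H : Polynomial ℝ}
    (hQ : MvPolynomial.aeval ![Polynomial.X, 0] (localEquation (homogenized (tangencyPoly f)) a b) =
      Polynomial.X ^ k * H) (hH : H.eval 0 ≠ 0) {ε : ℝ} (hε : 0 < ε) :
    ∃ R₀ : ℝ, ∀ R, R₀ ≤ R → ∀ γ ∈ tangencyEnds f R, EndsAt γ a b →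
      ∀ q ∈ γ, a * q 0 + b * q 1 ≠ 0 ∧ |chartU a b q| < ε := by
  have hc : 0 < a ^ 2 + b ^ 2 := lt_of_le_of_ne (by positivity) (add_sq_ne_zero hab).symm
  set c := a ^ 2 + b ^ 2 with hcdef
  set Q := localEquation (homogenized (tangencyPoly f)) a b with hQdef
  obtain ⟨ε₁, hε₁, hne⟩ : ∃ ε₁ > 0, ∀ s, |s| < ε₁ → H.eval s ≠ 0 := by
    obtain ⟨ε₁, hε₁, h⟩ := Metric.eventually_nhds_iff.1
      (H.continuous.continuousAt.eventually_ne hH)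
    exact ⟨ε₁, hε₁, fun s hs => h (by simpa using hs)⟩
  -- The curve will not meet `|u| = r` far out. Here `r < ε₁` keeps `H` nonzero at `±r`, and `r ≤ 1`
  -- makes `ax + by` comparable with the norm on `|u| = r`.
  obtain ⟨r, hr0, hrε, hr1, hrε₁⟩ : ∃ r : ℝ, 0 < r ∧ r ≤ ε ∧ r ≤ 1 ∧ r < ε₁ :=
    ⟨min (min ε 1) (ε₁ / 2), by positivity, (min_le_left _ _).trans (min_le_left _ _),
      (min_le_left _ _).trans (min_le_right _ _), (min_le_right _ _).trans_lt (by linarith)⟩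
  have hQ0 : ∀ s, MvPolynomial.eval ![s, 0] Q = s ^ k * H.eval s := fun s => by
    have h := congrArg (Polynomial.eval s) hQ
    rw [Polynomial.eval_mul, Polynomial.eval_pow, Polynomial.eval_X] at h
    rw [← h, ← Polynomial.coe_aeval_eq_eval, ← MvPolynomial.coe_aeval_eq_eval]
    change MvPolynomial.aeval _ Q = (Polynomial.aeval s) (MvPolynomial.aeval _ Q)
    rw [← AlgHom.comp_apply, MvPolynomial.comp_aeval]
    congr 2
    funext i
    fin_cases i <;> simp
  have hδ : ∀ s, |s| = r → ∃ δ > 0, ∀ v, |v| < δ → MvPolynomial.eval ![s, v] Q ≠ 0 :=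
    fun s hs => by
    have hcont : Continuous fun v : ℝ => MvPolynomial.eval ![s, v] Q :=
      Q.continuous_eval.comp (continuous_pi fun i => by fin_cases i <;> simp <;> fun_prop)
    have h0 : MvPolynomial.eval ![s, 0] Q ≠ 0 := by
      rw [hQ0]
      exact mul_ne_zero (pow_ne_zero _ fun h => by rw [h, abs_zero] at hs; linarith)
        (hne s (hs ▸ hrε₁))
    obtain ⟨δ, hδ, h⟩ := Metric.eventually_nhds_iff.1 (hcont.continuousAt.eventually_ne h0)
    exact ⟨δ, hδ, fun v hv => h (by simpa using hv)⟩
  obtain ⟨δ₁, hδ₁, h₁⟩ := hδ r (abs_of_pos hr0)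
  obtain ⟨δ₂, hδ₂, h₂⟩ := hδ (-r) (by rw [abs_neg, abs_of_pos hr0])
  obtain ⟨δ, hδ0, hδ1, hδ2⟩ : ∃ δ : ℝ, 0 < δ ∧ δ ≤ δ₁ ∧ δ ≤ δ₂ :=
    ⟨min δ₁ δ₂, by positivity, min_le_left _ _, min_le_right _ _⟩
  -- On `|u| = r ≤ 1` one has `c ‖q‖² ≤ 2 (ax + by)²`, so `|v| < δ` as soon as `(Rδ)² ≥ 2c`. Since
  -- `(2c + 1)² ≥ 2c`, this radius suffices.
  refine ⟨(2 * c + 1) / δ, fun R hR γ hγ hend => ?_⟩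
  have hR0 : 0 < R := lt_of_lt_of_le (by positivity) hR
  obtain ⟨⟨q₀, -, rfl⟩, hunb⟩ := hγ
  set γ := connectedComponentIn (exteriorTangencyCurve f R) q₀
  have hsub : γ ⊆ exteriorTangencyCurve f R := connectedComponentIn_subset _ _
  have := alongEnd_neBot hunb
  -- These are `|u| < r` and `|u| > r` with denominators cleared, hence open in the whole plane, the
  -- line `ax + by = 0` included. The end avoids `|u| = r` and enters `O₁` because `u → 0` along it,
  -- so by connectedness it stays in `O₁`.
  let O₁ : Set Plane := {q | |a * q 1 - b * q 0| < r * |a * q 0 + b * q 1|}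
  let O₂ : Set Plane := {q | r * |a * q 0 + b * q 1| < |a * q 1 - b * q 0|}
  have hO₁ : IsOpen O₁ := isOpen_lt (by fun_prop) (by fun_prop)
  have hO₂ : IsOpen O₂ := isOpen_lt (by fun_prop) (by fun_prop)
  have hU : ∀ q : Plane, |chartU a b q| = |a * q 1 - b * q 0| / |a * q 0 + b * q 1| :=
    fun q => abs_div _ _
  have hcover : γ ⊆ O₁ ∪ O₂ := fun q hq => by
    by_contra hcon
    have heq : |a * q 1 - b * q 0| = r * |a * q 0 + b * q 1| := by
      simp only [O₁, O₂, Set.mem_union, Set.mem_ofPred_eq, not_or, not_lt] at hcon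
      exact le_antisymm hcon.2 hcon.1
    obtain ⟨hT, hqR⟩ := hsub hq
    have hsq : (a * q 1 - b * q 0) ^ 2 = r ^ 2 * (a * q 0 + b * q 1) ^ 2 := by
      rw [← sq_abs, heq, mul_pow, sq_abs]
    have hnorm := norm_sq_eq_chart (a := a) (b := b) q
    rw [hsq] at hnorm
    have hw2 : c * R ^ 2 < 2 * (a * q 0 + b * q 1) ^ 2 := by
      have h3 : R ^ 2 < ‖q‖ ^ 2 := by gcongr
      have h4 : r ^ 2 ≤ 1 := pow_le_one₀ hr0.le hr1
      have h5 := mul_lt_mul_of_pos_left h3 hc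
      nlinarith [mul_le_mul_of_nonneg_right h4 (sq_nonneg (a * q 0 + b * q 1))]
    have hw : a * q 0 + b * q 1 ≠ 0 := fun h => by
      rw [h] at hw2
      have : 0 < c * R ^ 2 := by positivity
      linarith
    have hV : |chartV a b q| < δ := by
      rw [chartV, abs_div, ← hcdef, abs_of_pos hc, div_lt_iff₀ (abs_pos.2 hw)]
      refine lt_of_pow_lt_pow_left₀ 2 (by positivity) ?_
      rw [mul_pow, sq_abs]
      have h6 : 2 * c + 1 ≤ R * δ := (div_le_iff₀ hδ0).1 hR
      have h7 : (2 * c + 1) ^ 2 ≤ (R * δ) ^ 2 := by gcongr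
      have h8 := mul_lt_mul_of_pos_left hw2 (by positivity : 0 < δ ^ 2)
      nlinarith [mul_le_mul_of_nonneg_left h7 hc.le]
    have hUr : |chartU a b q| = r := by
      rw [hU, heq, mul_div_cancel_right₀ _ (abs_ne_zero.2 hw)]
    have hz : MvPolynomial.eval ![chartU a b q, chartV a b q] Q = 0 := by
      rw [eval_localEquation_homogenized _ hw, hT, mul_zero]
    rcases (abs_eq hr0.le).1 hUr with h | h
    · rw [h] at hz; exact h₁ _ (hV.trans_le hδ1) hz
    · rw [h] at hz; exact h₂ _ (hV.trans_le hδ2) hz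
  obtain ⟨q₁, hq₁, hq₁O⟩ : ∃ q ∈ γ, q ∈ O₁ := by
    have h3 : ∀ᶠ q in alongEnd γ, |chartU a b q| < r := by
      have := (hend.2.fst_nhds).abs
      simp only [abs_zero] at this
      exact this.eventually_lt_const hr0
    have h4 : ∀ᶠ q in alongEnd γ, q ∈ γ := mem_inf_of_right (mem_principal_self γ)
    obtain ⟨q, ⟨h5, h6⟩, h7⟩ := ((h3.and hend.1).and h4).exists
    refine ⟨q, h7, ?_⟩
    rwa [hU, div_lt_iff₀ (abs_pos.2 h6)] at h5
  have hdisj : Disjoint O₁ O₂ := Set.disjoint_left.2 fun q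
    (h : |a * q 1 - b * q 0| < r * |a * q 0 + b * q 1|)
    (h' : r * |a * q 0 + b * q 1| < |a * q 1 - b * q 0|) => lt_asymm h h'
  have hγO := isPreconnected_connectedComponentIn.subset_left_of_subset_union hO₁ hO₂ hdisj hcover
    ⟨q₁, hq₁, hq₁O⟩
  intro q hq
  have h5 : |a * q 1 - b * q 0| < r * |a * q 0 + b * q 1| := hγO hq
  have hw : a * q 0 + b * q 1 ≠ 0 := fun h => by
    rw [h, abs_zero, mul_zero] at h5
    exact absurd h5 (not_lt.2 (abs_nonneg _))
  refine ⟨hw, lt_of_lt_of_le ?_ hrε⟩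
  rwa [hU, div_lt_iff₀ (abs_pos.2 hw)]

end Chart

/-! ### Counting ends by two families of lines -/

section EndCount

open Polynomial

/-- For `P = Q(s, ts)` the exponent is the multiplicity of `Q` at the origin, and `τ` is a slope at
which the lowest form of `Q` does not vanish. -/
theorem exists_eq_X_pow_mul {P : ℝ[X][X]} (hP : P ≠ 0) :
    ∃ (m : ℕ) (g : ℝ[X][X]) (τ : ℝ), P = X ^ m * g ∧ (g.coeff 0).eval τ ≠ 0 := by
  obtain ⟨g, hg, hX⟩ := (FiniteMultiplicity.of_not_isUnit
    (not_isUnit_X (R := ℝ[X])) hP).exists_eq_pow_mul_and_not_dvd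
  rw [X_dvd_iff] at hX
  obtain ⟨τ, hτ⟩ : ∃ τ, (g.coeff 0).eval τ ≠ 0 := by
    by_contra! h
    exact hX (Polynomial.funext fun r => by rw [h, eval_zero])
  exact ⟨_, g, τ, hg, hτ⟩

/-- The number of ends at `[a, b, 0]` is at most twice the multiplicity `μ` there of the curve of
tangencies, and the number of ends tangent to the line at infinity is at most twice the difference
between the order of contact `k` with this line and `μ`. -/
theorem exists_forall_encard_ends_le {f : MvPolynomial (Fin 2) ℝ} {a b : ℝ}
    (hab : (a, b) ≠ (0, 0)) {k : ℕ} {H : ℝ[X]}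
    (hQ : MvPolynomial.aeval ![X, 0] (localEquation (homogenized (tangencyPoly f)) a b) =
      X ^ k * H) (hH : H.eval 0 ≠ 0) :
    ∃ μ ≤ k, ∃ R₀ : ℝ, ∀ R, R₀ ≤ R →
      {γ | γ ∈ tangencyEnds f R ∧ EndsAt γ a b}.encard ≤ 2 * μ ∧
      {γ | γ ∈ tangencyEnds f R ∧ EndsAt γ a b ∧ EndTangentToInfinity γ a b}.encard ≤
        2 * (k - μ : ℕ) := by
  set Q := localEquation (homogenized (tangencyPoly f)) a b with hQdef
  -- Lines through `p`: `u = s`, `v = ts`, with the slope `t` as parameter.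
  set w₁ : Fin 2 → ℝ[X][X] := ![X, C X * X] with hw₁
  have hmap₁ : ∀ t, (MvPolynomial.aeval w₁ Q).map (evalRingHom t) =
      MvPolynomial.aeval ![X, C t * X] Q := fun t => by
    rw [map_evalRingHom_aeval]
    congr 2
    funext i
    fin_cases i <;> simp [w₁]
  have hP0 : MvPolynomial.aeval w₁ Q ≠ 0 := fun h => by
    have h1 := hmap₁ 0
    rw [h, Polynomial.map_zero, C_0, zero_mul, hQ] at h1
    rcases mul_eq_zero.1 h1.symm with h2 | h2
    · exact pow_ne_zero _ X_ne_zero h2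
    · exact hH (by rw [h2, eval_zero])
  obtain ⟨μ, g, τ, hg, hτ⟩ := exists_eq_X_pow_mul hP0
  -- At slope 0 the line is `v = 0`. Comparing coefficients of degree `k` gives `μ ≤ k` and shows
  -- that `g(0,s)` has a nonzero coefficient in degree `k - μ`.
  have hg0 : X ^ μ * g.map (evalRingHom 0) = X ^ k * H := by
    rw [← hQ, ← zero_mul X, ← C_0, ← hmap₁, hg]; simp
  have hcoeff : (X ^ μ * g.map (evalRingHom 0)).coeff k ≠ 0 := by
    rw [hg0, coeff_X_pow_mul', if_pos le_rfl, Nat.sub_self, coeff_zero_eq_eval_zero]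
    exact hH
  rw [coeff_X_pow_mul'] at hcoeff
  have hμk : μ ≤ k := by
    by_contra h
    exact hcoeff (if_neg h)
  rw [if_pos hμk, coeff_map] at hcoeff
  -- Parallel lines of slope `τ`: `u = s`, `v = t + τs`. At `t = 0` the restriction of `Q` is `s ^ μ
  -- g(τ,s)`, whose coefficient in degree `μ` is `g(τ,0) ≠ 0`.
  set w₂ : Fin 2 → ℝ[X][X] := ![X, C X + C (C τ) * X] with hw₂
  have hmap₂ : (MvPolynomial.aeval w₂ Q).map (evalRingHom 0) =
      X ^ μ * g.map (evalRingHom τ) := by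
    have h1 : X ^ μ * g.map (evalRingHom τ) = MvPolynomial.aeval ![X, C τ * X] Q := by
      rw [← hmap₁, hg]; simp
    rw [h1, map_evalRingHom_aeval]
    congr 2
    funext i
    fin_cases i <;> simp [w₂]
  have hcoeff₂ : ((MvPolynomial.aeval w₂ Q).coeff μ).eval 0 ≠ 0 := by
    rw [← coe_evalRingHom, ← coeff_map, hmap₂, coeff_X_pow_mul', if_pos le_rfl, Nat.sub_self,
      coeff_map]
    exact hτ
  obtain ⟨ε₁, hε₁, hroots₁⟩ := exists_forall_card_roots_le g (k - μ) hcoeff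
  obtain ⟨ε₂, hε₂, hroots₂⟩ := exists_forall_card_roots_le _ μ hcoeff₂
  obtain ⟨ε₃, hε₃, hne⟩ := exists_forall_evalEval_ne_zero g (t := τ) (s := 0) (by
    rw [evalEval_eq_eval_map, ← coeff_zero_eq_eval_zero, coeff_map]; exact hτ)
  have heval₁ : ∀ t s, MvPolynomial.eval ![s, t * s] Q = s ^ μ * g.evalEval t s := fun t s => by
    have h1 := evalEval_aeval w₁ t s Q
    rw [hg, evalEval_mul, evalEval_pow, evalEval_X] at h1
    rw [h1]
    congr 2
    funext i
    fin_cases i <;> simp [w₁, evalEval_C]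
  have heval₂ : ∀ t s, (MvPolynomial.aeval w₂ Q).evalEval t s =
      MvPolynomial.eval ![s, t + τ * s] Q := fun t s => by
    rw [evalEval_aeval]
    congr 2
    funext i
    fin_cases i <;> simp [w₂, evalEval_C]
  obtain ⟨R₀, hR₀⟩ := exists_forall_end_subset_chart hab hQ hH
    (show 0 < min ε₁ (min ε₂ ε₃) by positivity)
  refine ⟨μ, hμk, R₀, fun R hR => ?_⟩
  have hchart : ∀ γ ∈ tangencyEnds f R, EndsAt γ a b → ∀ q ∈ γ,
      a * q 0 + b * q 1 ≠ 0 ∧ |chartU a b q| < ε₁ ∧ |chartU a b q| < ε₂ ∧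
        |chartU a b q| < ε₃ ∧ MvPolynomial.eval ![chartU a b q, chartV a b q] Q = 0 := by
    intro γ hγ hend q hq
    obtain ⟨h1, h2⟩ := hR₀ R hR γ hγ hend q hq
    obtain ⟨h3, h4⟩ := lt_min_iff.1 h2
    obtain ⟨h5, h6⟩ := lt_min_iff.1 h4
    refine ⟨h1, h3, h5, h6, ?_⟩
    obtain ⟨⟨q₀, -, rfl⟩, -⟩ := hγ
    rw [eval_localEquation_homogenized _ h1, (connectedComponentIn_subset _ _ hq).1, mul_zero]
  have hpre : ∀ γ ∈ tangencyEnds f R, IsPreconnected γ := by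
    rintro _ ⟨⟨q₀, -, rfl⟩, -⟩
    exact isPreconnected_connectedComponentIn
  have hmem : ∀ γ : Set Plane, ∀ᶠ q in alongEnd γ, q ∈ γ := fun γ =>
    mem_inf_of_right (mem_principal_self γ)
  constructor
  -- The curve meets `v = τu` near `p` only at `p`, which is not an affine point. So `v - τu` has no
  -- zero on an end, and its inverse is continuous there and unbounded.
  · have hW : ∀ γ ∈ tangencyEnds f R, EndsAt γ a b → ∀ q ∈ γ,
        chartV a b q - τ * chartU a b q ≠ 0 := by
      intro γ hγ hend q hq h
      obtain ⟨h1, -, -, h4, h5⟩ := hchart γ hγ hend q hq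
      rw [sub_eq_zero.1 h, heval₁] at h5
      have hU : chartU a b q ≠ 0 := fun h6 => by
        rw [h6, mul_zero, sub_zero] at h
        exact chartV_ne_zero hab h1 h
      rcases mul_eq_zero.1 h5 with h6 | h6
      · exact pow_ne_zero _ hU h6
      · exact hne τ _ (by simpa using hε₃) (by simpa using h4) h6
    refine encard_le_two_mul_of_forall_level_card_le
      (S := {γ | γ ∈ tangencyEnds f R ∧ EndsAt γ a b})
      (φ := fun q => (chartV a b q - τ * chartU a b q)⁻¹)
      (M₀ := 2 / ε₂) ((pairwiseDisjoint_tangencyEnds f R).subset fun γ hγ => hγ.1)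
      (fun γ hγ => hpre γ hγ.1) (fun γ hγ => ?_) (fun γ hγ M => ?_) fun M hM A hA => ?_
    · have h1 : ∀ q ∈ γ, a * q 0 + b * q 1 ≠ 0 := fun q hq => (hchart γ hγ.1 hγ.2 q hq).1
      exact ((continuousOn_chartV h1).sub ((continuousOn_chartU h1).const_mul τ)).inv₀
        (hW γ hγ.1 hγ.2)
    · have := alongEnd_neBot hγ.1.2
      have h1 : Tendsto (fun q => |chartV a b q - τ * chartU a b q|) (alongEnd γ) (𝓝 0) := by
        simpa using (hγ.2.2.snd_nhds.sub (hγ.2.2.fst_nhds.const_mul τ)).abs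
      obtain ⟨q, h2, hq⟩ := ((h1.eventually_lt_const
        (show 0 < (|M| + 1)⁻¹ by positivity)).and (hmem γ)).exists
      refine ⟨q, hq, ?_⟩
      have h3 := abs_pos.2 (hW γ hγ.1 hγ.2 q hq)
      rw [abs_inv]
      have h4 : |M| + 1 < |chartV a b q - τ * chartU a b q|⁻¹ :=
        (lt_inv_comm₀ h3 (by positivity)).1 h2
      linarith [le_abs_self M]
    · have hM0 : 0 < |M| := lt_of_lt_of_le (by positivity) hM
      have hinj : Set.InjOn (chartU a b) A := by
        intro q hq q' hq' h
        obtain ⟨⟨γ, hγ, hqγ⟩, h1⟩ := hA q hq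
        obtain ⟨⟨γ', hγ', hqγ'⟩, h1'⟩ := hA q' hq'
        refine chart_injective hab (hchart γ hγ.1 hγ.2 q hqγ).1 (hchart γ' hγ'.1 hγ'.2 q' hqγ').1
          h ?_
        have h2 := inv_injective (h1.trans h1'.symm)
        rw [h] at h2
        exact sub_left_injective h2
      -- On the level `M` the points lie on `v = M⁻¹ + τu`, so `u` determines them and is a small
      -- root of the family with parameter `M⁻¹`. The bound `|M| ≥ 2 / ε₂` makes `|M⁻¹| < ε₂`
      -- strict.
      rw [← Finset.card_image_of_injOn hinj]
      refine hroots₂ M⁻¹ ?_ _ fun s hs => ?_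
      · rw [abs_inv, inv_lt_comm₀ hM0 hε₂]
        refine lt_of_lt_of_le ?_ hM
        rw [inv_eq_one_div]
        gcongr
        norm_num
      · obtain ⟨q, hq, rfl⟩ := Finset.mem_image.1 hs
        obtain ⟨⟨γ, hγ, hqγ⟩, h1⟩ := hA q hq
        obtain ⟨-, -, h3, -, h5⟩ := hchart γ hγ.1 hγ.2 q hqγ
        refine ⟨h3, ?_⟩
        rw [heval₂, ← h1, inv_inv, sub_add_cancel]
        exact h5
  · have hV : ∀ γ ∈ tangencyEnds f R, EndsAt γ a b → ∀ q ∈ γ, chartV a b q ≠ 0 :=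
      fun γ hγ hend q hq => chartV_ne_zero hab (hchart γ hγ hend q hq).1
    refine encard_le_two_mul_of_forall_level_card_le
      (S := {γ | γ ∈ tangencyEnds f R ∧ EndsAt γ a b ∧ EndTangentToInfinity γ a b})
      (φ := fun q => chartU a b q / chartV a b q)
      (M₀ := 2 / ε₁) ((pairwiseDisjoint_tangencyEnds f R).subset fun γ hγ => hγ.1)
      (fun γ hγ => hpre γ hγ.1) (fun γ hγ => ?_) (fun γ hγ M => ?_) fun M hM A hA => ?_
    · have h1 : ∀ q ∈ γ, a * q 0 + b * q 1 ≠ 0 := fun q hq => (hchart γ hγ.1 hγ.2.1 q hq).1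
      exact (continuousOn_chartU h1).div (continuousOn_chartV h1) (hV γ hγ.1 hγ.2.1)
    · have := alongEnd_neBot hγ.1.2
      obtain ⟨q, h2, hq⟩ := ((hγ.2.2.def (show 0 < (|M| + 1)⁻¹ by positivity)).and
        (hmem γ)).exists
      refine ⟨q, hq, ?_⟩
      rw [Real.norm_eq_abs, Real.norm_eq_abs] at h2
      rw [abs_div, le_div_iff₀ (abs_pos.2 (hV γ hγ.1 hγ.2.1 q hq))]
      rw [inv_mul_eq_div, le_div_iff₀ (by positivity)] at h2
      nlinarith [le_abs_self M, abs_nonneg (chartV a b q)]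
    · have hM0 : 0 < |M| := lt_of_lt_of_le (by positivity) hM
      have hM1 : M ≠ 0 := abs_pos.1 hM0
      have hUV : ∀ q ∈ A, chartV a b q ≠ 0 ∧ chartV a b q = M⁻¹ * chartU a b q := fun q hq => by
        obtain ⟨⟨γ, hγ, hqγ⟩, h1⟩ := hA q hq
        have h2 := hV γ hγ.1 hγ.2.1 q hqγ
        refine ⟨h2, ?_⟩
        rw [← h1, inv_div]
        have h3 : chartU a b q ≠ 0 := fun h => hM1 (by rw [← h1, h, zero_div])
        field_simp
      have hinj : Set.InjOn (chartU a b) A := by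
        intro q hq q' hq' h
        obtain ⟨⟨γ, hγ, hqγ⟩, -⟩ := hA q hq
        obtain ⟨⟨γ', hγ', hqγ'⟩, -⟩ := hA q' hq'
        refine chart_injective hab (hchart γ hγ.1 hγ.2.1 q hqγ).1
          (hchart γ' hγ'.1 hγ'.2.1 q' hqγ').1 h ?_
        rw [(hUV q hq).2, (hUV q' hq').2, h]
      -- Here the level `M` of `u / v` is the line `v = M⁻¹u`. Since `u ≠ 0` on it away from `p`,
      -- the factor `u ^ μ` cancels and `u` is a small root of `g(M⁻¹, ·)`.
      rw [← Finset.card_image_of_injOn hinj]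
      refine hroots₁ M⁻¹ ?_ _ fun s hs => ?_
      · rw [abs_inv, inv_lt_comm₀ hM0 hε₁]
        refine lt_of_lt_of_le ?_ hM
        rw [inv_eq_one_div]
        gcongr
        norm_num
      · obtain ⟨q, hq, rfl⟩ := Finset.mem_image.1 hs
        obtain ⟨⟨γ, hγ, hqγ⟩, -⟩ := hA q hq
        obtain ⟨-, h2, -, -, h5⟩ := hchart γ hγ.1 hγ.2.1 q hqγ
        refine ⟨h2, ?_⟩
        rw [(hUV q hq).2, heval₁] at h5
        refine (mul_eq_zero.1 h5).resolve_left (pow_ne_zero _ fun h => (hUV q hq).1 ?_)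
        rw [(hUV q hq).2, h, mul_zero]

end EndCount

/-! ### The sums over the ends -/

theorem abs_endIndex_le (f : MvPolynomial (Fin 2) ℝ) (γ : Set Plane) : |endIndex f γ| ≤ 1 / 2 := by
  unfold endIndex
  split_ifs <;> norm_num [abs_le]

/-- An unbounded end has at most one limiting value, `OnePoint ℝ` being Hausdorff. So the pairs `(c,
γ)` inject into `S`, and each contributes at most `1/2`. -/
theorem tsum_abs_endIndex_le (f : MvPolynomial (Fin 2) ℝ) (p : OnePoint ℝ → Set Plane → Prop)
    (S : Set (Set Plane)) (hp : ∀ c γ, p c γ → γ ∈ S ∧ EndValue f γ c)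
    (hS : ∀ γ ∈ S, ¬ Bornology.IsBounded γ) :
    ∑' c, ∑' γ : {γ : Set Plane // p c γ}, ENNReal.ofReal |endIndex f γ.1| ≤
      S.encard * 2⁻¹ := by
  rw [← ENNReal.tsum_set_const,
    ← ENNReal.tsum_sigma fun c (γ : {γ : Set Plane // p c γ}) => ENNReal.ofReal |endIndex f γ.1|]
  let i : (Σ c, {γ : Set Plane // p c γ}) → S := fun x => ⟨x.2.1, (hp x.1 x.2.1 x.2.2).1⟩
  have hi : Function.Injective i := by
    rintro ⟨c, γ, h⟩ ⟨c', γ', h'⟩ heq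
    obtain rfl : γ = γ' := congrArg Subtype.val heq
    have := alongEnd_neBot (hS γ (hp c γ h).1)
    obtain rfl : c = c' := tendsto_nhds_unique (hp c γ h).2 (hp c' γ h').2
    rfl
  refine le_trans (ENNReal.tsum_le_tsum fun x => ?_)
    (ENNReal.tsum_comp_le_tsum_of_injective hi fun _ => 2⁻¹)
  refine ENNReal.ofReal_le_of_le_toReal ((abs_endIndex_le f _).trans ?_)
  norm_num

/-- A tangent end counts once among all ends and once more among the tangent ones, so the weighted
sum is at most half of `2μ + 2(k - μ)`. -/
theorem absIndex_le_of_encard_le {f : MvPolynomial (Fin 2) ℝ} {R a b : ℝ} {k μ : ℕ} (hμ : μ ≤ k)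
    (h₁ : {γ | γ ∈ tangencyEnds f R ∧ EndsAt γ a b}.encard ≤ 2 * μ)
    (h₂ : {γ | γ ∈ tangencyEnds f R ∧ EndsAt γ a b ∧ EndTangentToInfinity γ a b}.encard ≤
      2 * (k - μ : ℕ)) :
    absIndex f R a b ≤ k ∧ absIndexNormal f R a b + 2 * absIndexTangent f R a b ≤ k := by
  set E := {γ | γ ∈ tangencyEnds f R ∧ EndsAt γ a b} with hE
  set T := {γ | γ ∈ tangencyEnds f R ∧ EndsAt γ a b ∧ EndTangentToInfinity γ a b} with hT
  set N := {γ | γ ∈ tangencyEnds f R ∧ EndsAt γ a b ∧ ¬ EndTangentToInfinity γ a b} with hN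
  have hEe : (E.encard : ℝ≥0∞) ≤ 2 * μ := by exact_mod_cast ENat.toENNReal_le.2 h₁
  have hTe : (T.encard : ℝ≥0∞) ≤ 2 * (k - μ : ℕ) := by exact_mod_cast ENat.toENNReal_le.2 h₂
  have hNT : (N.encard : ℝ≥0∞) + T.encard = E.encard := by
    have hd : Disjoint N T := Set.disjoint_left.2 fun γ h h' => h.2.2 h'.2.2
    rw [← ENat.toENNReal_add, ← Set.encard_union_eq hd]
    congr 2
    ext γ
    simp only [hE, hN, hT, Set.mem_union, Set.mem_ofPred_eq]
    tauto
  have hEi : absIndex f R a b ≤ E.encard * 2⁻¹ :=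
    tsum_abs_endIndex_le f _ E (fun c γ h => ⟨⟨h.1, h.2.1⟩, h.2.2⟩) fun γ h => h.1.2
  have hTi : absIndexTangent f R a b ≤ T.encard * 2⁻¹ :=
    tsum_abs_endIndex_le f _ T (fun c γ h => ⟨⟨h.1, h.2.1, h.2.2.2⟩, h.2.2.1⟩) fun γ h => h.1.2
  have hNi : absIndexNormal f R a b ≤ N.encard * 2⁻¹ :=
    tsum_abs_endIndex_le f _ N (fun c γ h => ⟨⟨h.1, h.2.1, h.2.2.2⟩, h.2.2.1⟩) fun γ h => h.1.2
  have half : ∀ m : ℕ, (2 * m : ℝ≥0∞) * 2⁻¹ = m := fun m => by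
    rw [mul_comm, ← mul_assoc, ENNReal.inv_mul_cancel two_ne_zero ENNReal.ofNat_ne_top, one_mul]
  have hE2 : (E.encard : ℝ≥0∞) * 2⁻¹ ≤ μ := (mul_le_mul_left hEe _).trans_eq (half μ)
  have hT2 : (T.encard : ℝ≥0∞) * 2⁻¹ ≤ (k - μ : ℕ) :=
    (mul_le_mul_left hTe _).trans_eq (half (k - μ))
  refine ⟨(hEi.trans hE2).trans (by exact_mod_cast hμ), ?_⟩
  calc absIndexNormal f R a b + 2 * absIndexTangent f R a b
      ≤ N.encard * 2⁻¹ + 2 * (T.encard * 2⁻¹) := by gcongr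
    _ = E.encard * 2⁻¹ + T.encard * 2⁻¹ := by rw [← hNT]; ring
    _ ≤ μ + (k - μ : ℕ) := add_le_add hE2 hT2
    _ = k := by rw [← Nat.cast_add, Nat.add_sub_cancel' hμ]

/-! ### Independence of the homogeneous coordinates -/

theorem chartU_smul {t : ℝ} (ht : t ≠ 0) (a b : ℝ) : chartU (t * a) (t * b) = chartU a b := by
  funext q
  rw [chartU, chartU, ← mul_div_mul_left (a * q 1 - b * q 0) _ ht]
  congr 1 <;> ring

theorem chartV_smul {t : ℝ} (ht : t ≠ 0) (a b : ℝ) :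
    chartV (t * a) (t * b) = fun q => t * chartV a b q := by
  funext q
  rw [chartV, chartV, ← mul_div_assoc, ← mul_div_mul_left (t * _) _ ht]
  congr 1 <;> ring

theorem endsAt_smul {t : ℝ} (ht : t ≠ 0) (a b : ℝ) (γ : Set Plane) :
    EndsAt γ (t * a) (t * b) ↔ EndsAt γ a b := by
  have h1 : ∀ q : Plane, t * a * q 0 + t * b * q 1 ≠ 0 ↔ a * q 0 + b * q 1 ≠ 0 := fun q => by
    rw [show t * a * q 0 + t * b * q 1 = t * (a * q 0 + b * q 1) by ring, mul_ne_zero_iff]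
    exact and_iff_right ht
  simp only [EndsAt, h1, chartU_smul ht, chartV_smul ht, nhds_prod_eq, tendsto_prod_iff']
  refine and_congr_right' (and_congr_right' ⟨fun h => ?_, fun h => ?_⟩)
  · simpa [inv_mul_cancel_left₀ ht] using h.const_mul t⁻¹
  · simpa using h.const_mul t

theorem endTangentToInfinity_smul {t : ℝ} (ht : t ≠ 0) (a b : ℝ)
    (γ : Set Plane) :
    EndTangentToInfinity γ (t * a) (t * b) ↔ EndTangentToInfinity γ a b := by
  rw [EndTangentToInfinity, EndTangentToInfinity, chartU_smul ht, chartV_smul ht]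
  exact Asymptotics.isLittleO_const_mul_left_iff ht

theorem multAtInfinity_smul {t : ℝ} (ht : t ≠ 0) (a b : ℝ) (f : MvPolynomial (Fin 2) ℝ) :
    multAtInfinity f (t * a) (t * b) = multAtInfinity f a b := by
  refine multiplicity_eq_of_associated_left ?_
  have hu : IsUnit (MvPolynomial.C t : MvPolynomial (Fin 2) ℝ) := (IsUnit.mk0 t ht).map _
  refine ⟨hu.unit, ?_⟩
  simp only [IsUnit.unit_spec, map_mul]
  ring

theorem tsum_subtype_congr {α : Type*} {p q : α → Prop} (h : ∀ x, p x ↔ q x) (g : α → ℝ≥0∞) :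
    ∑' x : {x // p x}, g x.1 = ∑' x : {x // q x}, g x.1 := by
  obtain rfl : p = q := funext fun x => propext (h x)
  rfl

theorem absIndex_smul {t : ℝ} (ht : t ≠ 0) (a b : ℝ) (f : MvPolynomial (Fin 2) ℝ) (R : ℝ) :
    absIndex f R (t * a) (t * b) = absIndex f R a b := by
  exact tsum_congr fun c => tsum_subtype_congr (fun γ => by rw [endsAt_smul ht])
    fun γ => ENNReal.ofReal |endIndex f γ|

theorem absIndexTangent_smul {t : ℝ} (ht : t ≠ 0) (a b : ℝ) (f : MvPolynomial (Fin 2) ℝ) (R : ℝ) :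
    absIndexTangent f R (t * a) (t * b) = absIndexTangent f R a b := by
  exact tsum_congr fun c => tsum_subtype_congr
    (fun γ => by rw [endsAt_smul ht, endTangentToInfinity_smul ht])
    fun γ => ENNReal.ofReal |endIndex f γ|

theorem absIndexNormal_smul {t : ℝ} (ht : t ≠ 0) (a b : ℝ) (f : MvPolynomial (Fin 2) ℝ) (R : ℝ) :
    absIndexNormal f R (t * a) (t * b) = absIndexNormal f R a b := by
  exact tsum_congr fun c => tsum_subtype_congr
    (fun γ => by rw [endsAt_smul ht, endTangentToInfinity_smul ht])
    fun γ => ENNReal.ofReal |endIndex f γ|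

/-- The leading form of a nonzero polynomial vanishes at finitely many points `[1, s, 0]`. -/
theorem finite_setOf_multAtInfinity_one_pos {f : MvPolynomial (Fin 2) ℝ} (hf : f ≠ 0) :
    {s | 0 < multAtInfinity f 1 s}.Finite := by
  set F := MvPolynomial.homogeneousComponent f.totalDegree f with hF
  have hhom : F.IsHomogeneous f.totalDegree :=
    MvPolynomial.homogeneousComponent_isHomogeneous _ _
  set P : Polynomial ℝ := MvPolynomial.aeval ![1, Polynomial.X] F with hP
  have hPe : ∀ s, P.eval s = MvPolynomial.eval ![1, s] F := fun s => by
    rw [hP, ← Polynomial.coe_aeval_eq_eval, ← MvPolynomial.coe_aeval_eq_eval]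
    change (Polynomial.aeval s) (MvPolynomial.aeval _ F) = MvPolynomial.aeval _ F
    rw [← AlgHom.comp_apply, MvPolynomial.comp_aeval]
    congr 2
    funext i
    fin_cases i <;> simp
  have hP0 : P ≠ 0 := fun h0 => by
    -- By homogeneity a form vanishing at all `(1, s)` vanishes wherever `x ≠ 0`; the factor `X 0`
    -- takes care of `x = 0`.
    have h1 : MvPolynomial.X 0 * F = 0 := by
      refine MvPolynomial.funext fun x => ?_
      rw [map_mul, map_zero, MvPolynomial.eval_X]
      by_cases hx : x 0 = 0
      · rw [hx, zero_mul]
      · have h2 := MvPolynomial.aeval_mul_left_of_isHomogeneous hhom (x 0) ![1, x 1 / x 0]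
        have h3 : (fun i => x 0 * (![1, x 1 / x 0] : Fin 2 → ℝ) i) = x := by
          funext i
          fin_cases i
          · simp
          · simp [mul_div_cancel₀ _ hx]
        rw [h3] at h2
        have h4 : MvPolynomial.aeval ![1, x 1 / x 0] F = (0 : ℝ) := by
          have := hPe (x 1 / x 0)
          rw [h0, Polynomial.eval_zero] at this
          exact this.symm
        rw [h4, mul_zero] at h2
        rw [show MvPolynomial.eval x F = 0 from h2, mul_zero]
    exact homogeneousComponent_totalDegree_ne_zero hf
      ((mul_eq_zero.1 h1).resolve_left (MvPolynomial.X_ne_zero 0))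
  refine (P.roots.toFinset.finite_toSet).subset fun s hs => ?_
  simp only [Finset.mem_coe, Multiset.mem_toFinset, Polynomial.mem_roots hP0, Polynomial.IsRoot]
  rw [hPe]
  obtain ⟨g, hg⟩ := (dvd_pow_self _ (Nat.pos_iff_ne_zero.1 hs)).trans (pow_multiplicity_dvd _ F)
  rw [hg]
  simp

theorem exists_forall_absIndex_le {f : MvPolynomial (Fin 2) ℝ} (hf : f ≠ 0) {a b : ℝ}
    (hab : (a, b) ≠ (0, 0)) (hm : 0 < multAtInfinity f a b) :
    ∃ R₀ : ℝ, ∀ R : ℝ, R₀ ≤ R →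
      absIndex f R a b ≤ ((multAtInfinity f a b - 1 : ℕ) : ℝ≥0∞) ∧
      absIndexNormal f R a b + 2 * absIndexTangent f R a b ≤
        ((multAtInfinity f a b - 1 : ℕ) : ℝ≥0∞) := by
  obtain ⟨h, hh, hev⟩ := exists_leadingForm_tangencyPoly_eq hf hab hm
  obtain ⟨H, hQ, hH⟩ := aeval_localEquation_homogenized (add_sq_ne_zero hab) hh hev
  obtain ⟨μ, hμ, R₀, hR₀⟩ := exists_forall_encard_ends_le hab hQ hH
  exact ⟨R₀, fun R hR => absIndex_le_of_encard_le hμ (hR₀ R hR).1 (hR₀ R hR).2⟩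

/-- Every point is critical for the zero polynomial, and the plane has no isolated points. -/
theorem HasIsolatedCriticalPts.ne_zero {f : MvPolynomial (Fin 2) ℝ}
    (hf : HasIsolatedCriticalPts f) : f ≠ 0 := by
  rintro rfl
  have hcrit : ∀ q : Plane, IsCriticalPt 0 q := fun q i => by simp [polyVal]
  have := (hf 0 (hcrit 0)).mono fun x hx => hx (hcrit x)
  exact (Module.punctured_nhds_neBot ℝ Plane 0).ne (eventually_false_iff_eq_bot.1 this)

theorem mainTheorem7 (f : MvPolynomial (Fin 2) ℝ) (hf : HasIsolatedCriticalPts f) :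
    (∀ a b : ℝ, (a, b) ≠ (0, 0) → 0 < multAtInfinity f a b →
      tangencyIntersectionNumber f a b = ((multAtInfinity f a b - 1 : ℕ) : ℕ∞)) ∧
    ∃ R₀ : ℝ, ∀ R : ℝ, R₀ ≤ R →
      ∀ a b : ℝ, (a, b) ≠ (0, 0) → 0 < multAtInfinity f a b →
        absIndex f R a b ≤ ((multAtInfinity f a b - 1 : ℕ) : ℝ≥0∞) ∧
        absIndexNormal f R a b + 2 * absIndexTangent f R a b ≤
          ((multAtInfinity f a b - 1 : ℕ) : ℝ≥0∞) := by
  have hf0 := hf.ne_zero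
  refine ⟨fun a b hab hm => tangencyIntersectionNumber_eq hf0 hab hm, ?_⟩
  have hR : ∀ a b : ℝ, ∃ R₀ : ℝ, ∀ R : ℝ, R₀ ≤ R → (a, b) ≠ (0, 0) → 0 < multAtInfinity f a b →
      absIndex f R a b ≤ ((multAtInfinity f a b - 1 : ℕ) : ℝ≥0∞) ∧
      absIndexNormal f R a b + 2 * absIndexTangent f R a b ≤
        ((multAtInfinity f a b - 1 : ℕ) : ℝ≥0∞) := fun a b => by
    by_cases h : (a, b) ≠ (0, 0) ∧ 0 < multAtInfinity f a b
    · obtain ⟨R₀, hR₀⟩ := exists_forall_absIndex_le hf0 h.1 h.2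
      exact ⟨R₀, fun R hR _ _ => hR₀ R hR⟩
    · exact ⟨0, fun R _ h1 h2 => absurd ⟨h1, h2⟩ h⟩
  choose r hr using hR
  obtain ⟨B, hB⟩ := ((finite_setOf_multAtInfinity_one_pos hf0).image (r 1)).bddAbove
  -- `B` bounds the radii of the finitely many zeros `[1, s, 0]`; the point `[0, 1, 0]` is added
  -- separately. Every other representative is a multiple of one of these.
  refine ⟨max B (r 0 1), fun R hR a b hab hm => ?_⟩
  by_cases ha : a = 0
  · subst ha
    have hb : b ≠ 0 := fun h => hab (by rw [h])
    have h1 := multAtInfinity_smul hb 0 1 f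
    have h2 := absIndex_smul hb 0 1 f R
    have h3 := absIndexTangent_smul hb 0 1 f R
    have h4 := absIndexNormal_smul hb 0 1 f R
    rw [mul_zero, mul_one] at h1 h2 h3 h4
    rw [h1] at hm
    rw [h1, h2, h3, h4]
    exact hr 0 1 R ((le_max_right _ _).trans hR) (by simp) hm
  · have h1 := multAtInfinity_smul ha 1 (b / a) f
    have h2 := absIndex_smul ha 1 (b / a) f R
    have h3 := absIndexTangent_smul ha 1 (b / a) f R
    have h4 := absIndexNormal_smul ha 1 (b / a) f R
    rw [mul_one, mul_div_cancel₀ _ ha] at h1 h2 h3 h4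
    rw [h1] at hm
    rw [h1, h2, h3, h4]
    exact hr 1 (b / a) R
      ((hB (Set.mem_image_of_mem _ hm)).trans ((le_max_left _ _).trans hR)) (by simp) hm
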